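/- Let $0<r<n$, $d\in\mathbb N$, and consider the constant-coefficient system $$U_t+\sum_{k=1}^d\bar A^{(k)}U_{x_k}=-\bar B\,U,\qquad \bar A^{(k)}=\begin{pmatrix}\bar a_k&\bar b_k\\ \bar c_k&\bar d_k\end{pmatrix},\qquad \bar B=\begin{pmatrix}0&0\\0&\bar e\end{pmatrix},$$ with $\bar a_k\in\mathbb R^{(n-r)\times(n-r)}$, $\bar b_k\in\mathbb R^{(n-r)\times r}$, $\bar c_k\in\mathbb R^{r\times(n-r)}$, $\bar d_k\in\mathbb R^{r\times r}$, and $\bar e\in\mathbb R^{r\times r}$ invertible. Assume: (i) there is a symmetric positive definite matrix $A^{(0)}=\mathrm{diag}(X_1,X_2)$, $X_1\in\mathbb R^{(n-r)\times(n-r)}$, $X_2\in\mathbb R^{r\times r}$, such that all $A^{(0)}\bar A^{(k)}$ are symmetric; (ii) $X_2\bar e+\bar e^TX_2$ is positive definite; (iii) there are real numbers $\alpha_1,\dots,\alpha_d$ such that $\sum_k\alpha_k\bar a_k$ has only negative eigenvalues. Put $S=(A^{(0)})^{1/2}$, $A^{(k)}=S^{-1}A^{(0)}\bar A^{(k)}S^{-1}$,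 $B=S^{-1}A^{(0)}\bar B S^{-1}$, and $R=-(B+B^T)$. Then the $A^{(k)}$ are symmetric, and if $U$ is a classical solution of the system above on $[0,T)\times\Omega$ ($\Omega\subset\mathbb R^d$ open) then $w=SU$ is a classical solution of $w_t+\sum_kA^{(k)}w_{x_k}+Bw=0$ there; here a classical solution is one that is $C^1$ on $[0,T)\times\overline\Omega$. Moreover there is $K_0>0$ such that for every $K\ge K_0$ there is a constant $C>0$ for which the linear potential $\mu(x)=\sum_k\frac{\alpha_k}{K}x_k$, with $m_k=\partial_{x_k}\mu=\alpha_k/K$, is feasible in the sense that $$C\,\mathrm{Id}+R+\sum_{k=1}^dm_kA^{(k)}\le 0\quad\text{(negative semidefinite)},$$ and the following holds. Let $\Omega\subset\mathbb R^d$ be bounded and open with piecewise $C^1$ boundary (that is, $\partial\Omega$ has finite $(d-1)$-dimensional surface measure and, outside a set of surface measure zero, is locally a $C^1$ hypersurface with $\Omega$ on one side), with outward unit normal $\mathbf n$. Let $T>0$, let $U$ be a classical solution on $[0,T)\times\Omega$, let $w=SU$, and suppose that its boundary values satisfy $$\int_{\partial\Omega}w(t,x)^T\Big(\sum_{k=1}^dn_k(x)A^{(k)}\Big)w(t,x)\,e^{\mu(x)}\,ds(x)\ge0\qquad\text{for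 all }t\in[0,T).$$ Then the Lyapunov function $L(t)=\int_\Omega w(t,x)^Tw(t,x)\,e^{\mu(x)}\,dx$ satisfies $L(t)\le e^{-Ct}L(0)$ for all $t\in[0,T)$. -/

import Mathlib

open MeasureTheory Set
open scoped Matrix MatrixOrder

noncomputable section

namespace HypStab

/-- The physical space `ℝ^d` with its Euclidean norm. -/
abbrev Space (d : ℕ) := EuclideanSpace ℝ (Fin d)

/-! ### Domains with piecewise `C¹` boundary -/

/-- `φ` is a `C¹` defining function of `Ω` near `x`: `φ` is `C¹` near `x`, vanishes at `x` with
nonzero gradient there, and near `x` the set `Ω` is `{φ < 0}`. -/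
structure IsLocalDefiningFunction {d : ℕ} (Ω : Set (Space d)) (φ : Space d → ℝ)
    (x : Space d) : Prop where
  contDiffAt : ContDiffAt ℝ 1 φ x
  eq_zero : φ x = 0
  gradient_ne_zero : gradient φ x ≠ 0
  eventually_mem_iff : ∀ᶠ y in nhds x, (y ∈ Ω ↔ φ y < 0)

/-- Near `x` the boundary of `Ω` is a `C¹` hypersurface with `Ω` on exactly one side. -/
def IsRegularBoundaryPoint {d : ℕ} (Ω : Set (Space d)) (x : Space d) : Prop :=
  ∃ φ : Space d → ℝ, IsLocalDefiningFunction Ω φ x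

/-- `ν` is the outward unit normal of `Ω` at the regular boundary point `x`. -/
def IsOuterUnitNormal {d : ℕ} (Ω : Set (Space d)) (x ν : Space d) : Prop :=
  ∃ φ : Space d → ℝ, IsLocalDefiningFunction Ω φ x ∧ ν = ‖gradient φ x‖⁻¹ • gradient φ x

open Classical in
/-- The outward unit normal field (zero at the points which are not regular). -/
def outerNormal {d : ℕ} (Ω : Set (Space d)) (x : Space d) : Space d :=
  if h : ∃ ν, IsOuterUnitNormal Ω x ν then h.choose else 0

/-- Piecewise `C¹` boundary: the boundary has finite surface measure and is, outside a set of
surface measure zero (edges, corners), locally a `C¹` hypersurface with `Ω` on one side. The surface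
measure is the Euclidean `(d - 1)`-dimensional Hausdorff measure. -/
structure HasPiecewiseC1Boundary {d : ℕ} (Ω : Set (Space d)) : Prop where
  finite : μHE[d - 1] (frontier Ω) < ⊤
  null_singular : μHE[d - 1] {x ∈ frontier Ω | ¬ IsRegularBoundaryPoint Ω x} = 0

/-! ### Linear first order systems -/

/-- `w` is a classical solution, `C¹` up to the boundary, of
`w_t + ∑ k, A⁽ᵏ⁾(x) w_{x_k} + B(x) w = 0` on `[0, T) × Ω`. -/
structure IsClassicalSolution {d : ℕ} {ι : Type*} [Fintype ι]
    (A : Fin d → Space d → Matrix ι ι ℝ) (B : Space d → Matrix ι ι ℝ)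
    (T : ℝ) (Ω : Set (Space d)) (w : ℝ → Space d → ι → ℝ) : Prop where
  contDiffOn : ContDiffOn ℝ 1 (fun z : ℝ × Space d => w z.1 z.2) (Ico 0 T ×ˢ closure Ω)
  equation : ∀ t ∈ Ioo 0 T, ∀ x ∈ Ω,
    deriv (fun s => w s x) t
      + ∑ k, A k x *ᵥ fderiv ℝ (w t) x (EuclideanSpace.single k 1)
      + B x *ᵥ w t x = 0

/-- The symmetric part of a matrix. -/
def symPart {ι : Type*} (B : Matrix ι ι ℝ) : Matrix ι ι ℝ := (1 / 2 : ℝ) • (B + Bᵀ)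

/-- The remainder `R(x) = ∑ k, ∂A⁽ᵏ⁾/∂x_k (x) - 2 B^sym(x)`. -/
def remainder {d : ℕ} {ι : Type*}
    (A : Fin d → Space d → Matrix ι ι ℝ) (B : Space d → Matrix ι ι ℝ) (x : Space d) :
    Matrix ι ι ℝ :=
  (∑ k, Matrix.of fun i j => fderiv ℝ (fun y => A k y i j) x (EuclideanSpace.single k 1))
    - (2 : ℝ) • symPart (B x)

/-- `μ` is a feasible Lyapunov potential with constant `C`: with `m = ∇μ` the linear matrix
inequality `C Id + R(x) + ∑ k, m_k(x) A⁽ᵏ⁾(x) ≤ 0` (negative semidefinite) holds everywhere. -/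
structure IsFeasiblePotential {d : ℕ} {ι : Type*} [DecidableEq ι]
    (A : Fin d → Space d → Matrix ι ι ℝ) (B : Space d → Matrix ι ι ℝ)
    (C : ℝ) (μ : Space d → ℝ) : Prop where
  contDiff : ContDiff ℝ 1 μ
  lmi : ∀ x, (-(C • (1 : Matrix ι ι ℝ) + remainder A B x
    + ∑ k, gradient μ x k • A k x)).PosSemidef

/-- The Lyapunov function `L(t) = ∫_Ω wᵀ w exp(μ) dx`. -/
def lyapunov {d : ℕ} {ι : Type*} [Fintype ι] (Ω : Set (Space d)) (μ : Space d → ℝ)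
    (w : ℝ → Space d → ι → ℝ) (t : ℝ) : ℝ :=
  ∫ x in Ω, (w t x ⬝ᵥ w t x) * Real.exp (μ x)

/-- The boundary term `∫_{∂Ω} wᵀ (∑ k, n_k A⁽ᵏ⁾) w exp(μ) ds`, with `n` the outward normal. -/
def boundaryTerm {d : ℕ} {ι : Type*} [Fintype ι] (A : Fin d → Space d → Matrix ι ι ℝ)
    (Ω : Set (Space d)) (μ : Space d → ℝ) (w : ℝ → Space d → ι → ℝ) (t : ℝ) : ℝ :=
  ∫ x in frontier Ω,
    (w t x ⬝ᵥ ((∑ k, outerNormal Ω x k • A k x) *ᵥ w t x)) * Real.exp (μ x) ∂μHE[d - 1]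

/-! ### Symmetrization and the structured system -/

/-- The coefficient matrix `S⁻¹ (A₀ M) S⁻¹`, `S = A₀^(1/2)`, of the system for `w = S U`. -/
def symmetrized {ι : Type*} [Fintype ι] [DecidableEq ι] (A₀ M : Matrix ι ι ℝ) : Matrix ι ι ℝ :=
  (CFC.sqrt A₀)⁻¹ * (A₀ * M) * (CFC.sqrt A₀)⁻¹

/-- Block structure with properties (i)-(iii), for the system
`U_t + ∑ k, Abar⁽ᵏ⁾ U_{x_k} = - Bbar U`, where `Abar⁽ᵏ⁾` has the blocks `a k, b k, c k, e k` and
`Bbar = diag(0, f)`; `A₀ = diag(X₁, X₂)`. By `symmetric` all eigenvalues in `negative` are real. -/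
structure SatisfiesSSC {d p r : ℕ}
    (a : Fin d → Matrix (Fin p) (Fin p) ℝ) (b : Fin d → Matrix (Fin p) (Fin r) ℝ)
    (c : Fin d → Matrix (Fin r) (Fin p) ℝ) (e : Fin d → Matrix (Fin r) (Fin r) ℝ)
    (f : Matrix (Fin r) (Fin r) ℝ)
    (X₁ : Matrix (Fin p) (Fin p) ℝ) (X₂ : Matrix (Fin r) (Fin r) ℝ) (α : Fin d → ℝ) : Prop where
  isUnit : IsUnit f
  posDef : (Matrix.fromBlocks X₁ 0 0 X₂).PosDef
  symmetric : ∀ k, (Matrix.fromBlocks X₁ 0 0 X₂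
    * Matrix.fromBlocks (a k) (b k) (c k) (e k)).IsSymm
  dissipative : (X₂ * f + fᵀ * X₂).PosDef
  negative : ∀ ev : ℝ, Module.End.HasEigenvalue (Matrix.toLin' (∑ k, α k • a k)) ev → ev < 0

/-- The linear potential `μ(x) = ∑ k, (α_k / K) x_k`. -/
def linearPotential {d : ℕ} (α : Fin d → ℝ) (K : ℝ) (x : Space d) : ℝ := ∑ k, α k / K * x k

end HypStab

end

/-! The algebra and the analysis are independent. Algebra: with `S = CFC.sqrt A₀` the symmetrized
matrices satisfy `A⁽ᵏ⁾ S = S Abar⁽ᵏ⁾`, so `S` carries solutions to solutions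
(`IsClassicalSolution.mulVec`). Congruence with `S` turns the matrix inequality into positive
definiteness of `diag(0, X₂ f + fᵀ X₂) - K⁻¹ M`, where `M = A₀ ∑ α_k Abar⁽ᵏ⁾`. The first block `X₁ ∑
α_k a_k` of `M` is negative definite (`posDef_neg_mul`), and a Schur complement shows that the
dissipative block absorbs the rest for large `K` (`exists_posDef_smul_sub_fromBlocks`). A positive
lower bound of the spectrum is the decay rate `C`.

Analysis: inserting the equation into `L'` and using symmetry of the `A⁽ᵏ⁾` leaves minus the
integral of the divergence of `wᵀ A⁽ᵏ⁾ w exp(μ)`, plus a zero-order term that the matrix inequality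
bounds by `-C L`. The divergence integrates to the boundary term, which is nonnegative, so `L' ≤ -C
L`, and `exp(C t) L(t)` is nonincreasing.

The bulk of the file is the Gauss-Green formula (`gaussDefect_eq_zero`) for such domains. Near a
regular point the boundary is almost flat. For a direction `u` within angle `θ` of the normal,
Fubini and the fundamental theorem of calculus on lines give the surface integral of `f`, with an
error `O(θ²) ∫ |f|`, because projecting along `u` distorts surface measure only to second order. Any
direction `v` is a difference of two such directions divided by a multiple of `θ`, so its error is
`O(θ) ∫ |f|`. A partition of unity adds these errors to `ε ∫ |f|` with `ε` arbitrary, so the defect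
vanishes away from the singular set. That set has zero `(d - 1)`-dimensional measure and is removed
by cutoffs whose gradients have small `L¹` norm. -/

namespace HypStab

/-! ### Fubini along a fixed direction. -/

section Slices

variable {E : Type*} [NormedAddCommGroup E] [InnerProductSpace ℝ E] [FiniteDimensional ℝ E]
  [MeasurableSpace E] [BorelSpace E]

/-- The orthogonal splitting of a Euclidean space into a line and a hyperplane. -/
noncomputable def lineHyperplaneEquiv (u : E) (hu : ‖u‖ = 1) : (ℝ × (ℝ ∙ u)ᗮ) ≃ᵐ E :=
  ((LinearIsometryEquiv.toSpanUnitSingleton (𝕜 := ℝ) u hu).toHomeomorph.toMeasurableEquiv.prodCongr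
    (MeasurableEquiv.refl _)).trans ((ℝ ∙ u).measurableEquivProd (0 : E)).symm

theorem lineHyperplaneEquiv_apply (u : E) (hu : ‖u‖ = 1) (z : ℝ × (ℝ ∙ u)ᗮ) :
    lineHyperplaneEquiv u hu z = z.1 • u + (z.2 : E) := by
  have : lineHyperplaneEquiv u hu z = ((ℝ ∙ u).measurableEquivProd (0 : E)).symm
      (LinearIsometryEquiv.toSpanUnitSingleton (𝕜 := ℝ) u hu z.1, z.2) := rfl
  rw [this, Submodule.measurableEquivProd_symm_apply]
  simp

theorem measurePreserving_lineHyperplaneEquiv (u : E) (hu : ‖u‖ = 1) :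
    MeasurePreserving (lineHyperplaneEquiv u hu) (volume.prod volume) volume := by
  have h1 := (ℝ ∙ u).measurePreserving_measurableEquivProd (0 : E)
  rw [InnerProductSpace.euclideanHausdorffMeasure_eq_volume] at h1
  have h2 : MeasurePreserving
      (LinearIsometryEquiv.toSpanUnitSingleton (𝕜 := ℝ) u hu) volume volume :=
    LinearIsometryEquiv.measurePreserving _
  exact (MeasurePreserving.symm _ h1).comp (h2.prod (MeasurePreserving.id volume))

theorem integrable_slice {u : E} (hu : ‖u‖ = 1) {h : E → ℝ} (hh : Integrable h) :
    Integrable fun y : (ℝ ∙ u)ᗮ => ∫ s : ℝ, h (s • u + y) := by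
  have := ((measurePreserving_lineHyperplaneEquiv u hu).integrable_comp_emb
    (lineHyperplaneEquiv u hu).measurableEmbedding).2 hh
  simpa [lineHyperplaneEquiv_apply] using this.integral_prod_right

theorem integral_eq_integral_slice {u : E} (hu : ‖u‖ = 1) {h : E → ℝ} (hh : Integrable h) :
    ∫ x, h x = ∫ y : (ℝ ∙ u)ᗮ, ∫ s : ℝ, h (s • u + y) := by
  have := ((measurePreserving_lineHyperplaneEquiv u hu).integrable_comp_emb
    (lineHyperplaneEquiv u hu).measurableEmbedding).2 hh
  rw [← (measurePreserving_lineHyperplaneEquiv u hu).integral_comp']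
  refine (integral_prod_symm _ this).trans ?_
  simp [lineHyperplaneEquiv_apply]

end Slices

/-! ### Comparison of measures, and surface measure under bi-Lipschitz projections. -/

section Compare

variable {α : Type*} [MeasurableSpace α]

/-- For nonnegative integrands the two integrals differ by a factor between `1` and `1 + ε`; the
signed case follows by splitting into positive and negative parts. -/
theorem abs_integral_sub_integral_le {l n : Measure α} {ε : ℝ} (hε : 0 ≤ ε) (hln : l ≤ n)
    (hnl : n ≤ ENNReal.ofReal (1 + ε) • l) {k : α → ℝ} (hk : Integrable k n) :
    |∫ x, k x ∂n - ∫ x, k x ∂l| ≤ ε * ∫ x, |k x| ∂n := by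
  have hkl : Integrable k l := hk.mono_measure hln
  have key : ∀ g : α → ℝ, Integrable g n → (∀ x, 0 ≤ g x) →
      ∫ x, g x ∂l ≤ ∫ x, g x ∂n ∧ ∫ x, g x ∂n ≤ (1 + ε) * ∫ x, g x ∂l := by
    intro g hg h0
    refine ⟨integral_mono_measure hln (.of_forall h0) hg, ?_⟩
    have := integral_mono_measure hnl (.of_forall h0)
      ((hg.mono_measure hln).smul_measure ENNReal.ofReal_ne_top)
    rwa [integral_smul_measure, ENNReal.toReal_ofReal (by positivity), smul_eq_mul] at this
  have hp := key _ hk.pos_part fun x => le_max_right _ _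
  have hm := key _ hk.neg_part fun x => le_max_right _ _
  have e1 : ∀ μ : Measure α, Integrable k μ →
      ∫ x, k x ∂μ = ∫ x, max (k x) 0 ∂μ - ∫ x, max (-k x) 0 ∂μ := by
    intro μ hμ
    rw [← integral_sub hμ.pos_part hμ.neg_part]
    congr with x
    rcases le_total (k x) 0 with h | h <;> simp [h]
  have e2 : ∫ x, |k x| ∂n = ∫ x, max (k x) 0 ∂n + ∫ x, max (-k x) 0 ∂n := by
    rw [← integral_add hk.pos_part hk.neg_part]
    congr with x
    rcases le_total (k x) 0 with h | h <;> simp [h, abs_of_nonneg, abs_of_nonpos]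
  rw [e1 n hk, e1 l hkl, e2, abs_le]
  constructor <;> nlinarith

end Compare

section Projection

variable {X Y : Type*} [MetricSpace X] [MeasurableSpace X] [BorelSpace X]
  [MetricSpace Y] [MeasurableSpace Y] [BorelSpace Y]

theorem euclideanHausdorffMeasure_image_le {m : ℕ} {K : NNReal} {f : X → Y} {s : Set X}
    (hf : LipschitzOnWith K f s) : μHE[m] (f '' s) ≤ (K : ENNReal) ^ m * μHE[m] s := by
  simp only [Measure.euclideanHausdorffMeasure_def, Measure.smul_apply]
  have := hf.hausdorffMeasure_image_le (d := m) (Nat.cast_nonneg _)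
  simp only [ENNReal.rpow_natCast] at this
  simp only [ENNReal.smul_def, smul_eq_mul]
  rw [mul_left_comm]
  gcongr

/-- The hypothesis makes `f` injective on `s` with a `K`-Lipschitz inverse, to which the Lipschitz
bound applies. -/
theorem le_euclideanHausdorffMeasure_image {m : ℕ} {K : NNReal} {f : X → Y} {s : Set X}
    (hf : ∀ x ∈ s, ∀ y ∈ s, dist x y ≤ K * dist (f x) (f y)) :
    μHE[m] s ≤ (K : ENNReal) ^ m * μHE[m] (f '' s) := by
  have hinj : InjOn f s := by
    intro x hx y hy hxy
    have := hf x hx y hy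
    rw [hxy, dist_self, mul_zero] at this
    exact dist_le_zero.1 this
  rcases isEmpty_or_nonempty X with h | h
  · simp [Subsingleton.elim s ∅]
  have : LipschitzOnWith K (Function.invFunOn f s) (f '' s) := by
    refine LipschitzOnWith.of_dist_le_mul ?_
    rintro _ ⟨x, hx, rfl⟩ _ ⟨y, hy, rfl⟩
    rw [hinj.leftInvOn_invFunOn hx, hinj.leftInvOn_invFunOn hy]
    exact hf x hx y hy
  have h2 := euclideanHausdorffMeasure_image_le (m := m) this
  rwa [hinj.leftInvOn_invFunOn.image_image] at h2

/-- A projection which is bi-Lipschitz on a set transports the surface measure of the set to a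
measure comparable with the surface measure of the image. -/
theorem compare_map_restrict {m : ℕ} {K : NNReal} {f : X → Y} {S : Set X}
    (hf : LipschitzWith 1 f)
    (hf' : ∀ x ∈ S, ∀ y ∈ S, dist x y ≤ K * dist (f x) (f y)) :
    (μHE[m] : Measure Y).restrict (f '' S) ≤ ((μHE[m] : Measure X).restrict S).map f ∧
    ((μHE[m] : Measure X).restrict S).map f
      ≤ (K : ENNReal) ^ m • (μHE[m] : Measure Y).restrict (f '' S) := by
  have e : ∀ s : Set Y, f '' (f ⁻¹' s ∩ S) = s ∩ f '' S := fun s => by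
    rw [inter_comm, image_inter_preimage, inter_comm]
  constructor
  · refine Measure.le_iff.2 fun s hs => ?_
    rw [Measure.map_apply hf.continuous.measurable hs, Measure.restrict_apply hs,
      Measure.restrict_apply (hf.continuous.measurable hs), ← e]
    simpa using euclideanHausdorffMeasure_image_le (m := m) (hf.lipschitzOnWith (s := f ⁻¹' s ∩ S))
  · refine Measure.le_iff.2 fun s hs => ?_
    rw [Measure.map_apply hf.continuous.measurable hs, Measure.smul_apply,
      Measure.restrict_apply hs, Measure.restrict_apply (hf.continuous.measurable hs), ← e]
    exact le_euclideanHausdorffMeasure_image fun x hx y hy => hf' x hx.2 y hy.2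

end Projection

/-- Functions which are continuous up to the boundary and have a bounded derivative inside. -/
structure HasBoundedDerivOn {E : Type*} [NormedAddCommGroup E] [NormedSpace ℝ E]
    (Ω : Set E) (f : E → ℝ) : Prop where
  continuousOn : ContinuousOn f (closure Ω)
  differentiableOn : DifferentiableOn ℝ f Ω
  bounded : ∃ M, ∀ x ∈ Ω, ‖fderiv ℝ f x‖ ≤ M

/-- If there is no zero, the change point is put at an endpoint of the interval. This keeps one
formula for all lines below: the endpoints lie outside the ball supporting the integrand, so they
contribute nothing. -/
theorem exists_sign_change {a b : ℝ} (hab : a ≤ b) {ψ : ℝ → ℝ} (hc : ContinuousOn ψ (Icc a b))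
    (hm : StrictMonoOn ψ (Icc a b)) :
    ∃ g ∈ Icc a b, (∀ s ∈ Ico a g, ψ s < 0) ∧ (∀ s ∈ Ioc g b, 0 < ψ s) ∧
      (ψ g = 0 ∨ g = a ∨ g = b) := by
  have ha : a ∈ Icc a b := left_mem_Icc.2 hab
  have hb : b ∈ Icc a b := right_mem_Icc.2 hab
  rcases le_or_gt 0 (ψ a) with h0 | h0
  · exact ⟨a, ha, fun s hs => absurd hs.1 (not_le.2 hs.2),
      fun s hs => h0.trans_lt (hm ha ⟨hs.1.le, hs.2⟩ hs.1), .inr (.inl rfl)⟩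
  rcases le_or_gt (ψ b) 0 with h1 | h1
  · exact ⟨b, hb, fun s hs => (hm ⟨hs.1, hs.2.le⟩ hb hs.2).trans_le h1,
      fun s hs => absurd hs.2 (not_le.2 hs.1), .inr (.inr rfl)⟩
  obtain ⟨g, hg, hg0⟩ := intermediate_value_Icc hab hc ⟨h0.le, h1.le⟩
  refine ⟨g, hg, fun s hs => ?_, fun s hs => ?_, .inl hg0⟩
  · rw [← hg0]; exact hm ⟨hs.1, hs.2.le.trans hg.2⟩ hg hs.2
  · rw [← hg0]; exact hm hg ⟨hg.1.trans hs.1.le, hs.2⟩ hs.1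

/-! ### Almost flat boundary pieces and integration along transversal lines. -/

section Local

variable {E : Type*} [NormedAddCommGroup E] [InnerProductSpace ℝ E]

local notation "⟪" x ", " y "⟫" => inner ℝ x y

/-- Near `x₀` the set `Ω` is the sublevel set of a function which deviates from the linear function
with gradient `n₀` by a function with Lipschitz constant `δ`. -/
structure IsAlmostHalfSpace (Ω : Set E) (φ : E → ℝ) (x₀ n₀ : E) (ρ δ : ℝ) : Prop where
  pos : 0 < ρ
  norm_eq : ‖n₀‖ = 1
  mem_iff : ∀ x ∈ Metric.ball x₀ (2 * ρ), (x ∈ Ω ↔ φ x < 0)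
  approx : ∀ x ∈ Metric.ball x₀ (2 * ρ), ∀ y ∈ Metric.ball x₀ (2 * ρ),
    |φ x - φ y - ⟪n₀, x - y⟫| ≤ δ * ‖x - y‖

namespace IsAlmostHalfSpace

variable {Ω : Set E} {φ : E → ℝ} {x₀ n₀ u : E} {ρ δ θ : ℝ}

theorem continuousOn (h : IsAlmostHalfSpace Ω φ x₀ n₀ ρ δ) :
    ContinuousOn φ (Metric.ball x₀ (2 * ρ)) := by
  have : LipschitzOnWith (δ + 1).toNNReal φ (Metric.ball x₀ (2 * ρ)) := by
    refine LipschitzOnWith.of_dist_le_mul fun x hx y hy => ?_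
    have h1 := h.approx x hx y hy
    have h2 := abs_real_inner_le_norm n₀ (x - y)
    rw [h.norm_eq, one_mul] at h2
    rw [Real.dist_eq, dist_eq_norm]
    have : |φ x - φ y| ≤ (δ + 1) * ‖x - y‖ := by
      rw [abs_le] at *
      constructor <;> linarith
    refine this.trans ?_
    gcongr
    exact Real.le_coe_toNNReal _
  exact this.continuousOn

theorem inner_ge (h : IsAlmostHalfSpace Ω φ x₀ n₀ ρ δ) (hu : ‖u‖ = 1) (hun : ‖u - n₀‖ ≤ θ) :
    1 - θ ^ 2 / 2 ≤ ⟪n₀, u⟫ := by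
  have h1 := norm_sub_sq_real u n₀
  rw [hu, h.norm_eq, real_inner_comm] at h1
  have : ‖u - n₀‖ ^ 2 ≤ θ ^ 2 := by gcongr
  linarith

/-- Along `u` the function `φ` grows at rate at least `⟪n₀, u⟫ - δ ≥ 1 - θ²/2 - θ > 0`. Hence each
line in direction `u` crosses the boundary at most once inside the ball. -/
theorem lt_of_lt (h : IsAlmostHalfSpace Ω φ x₀ n₀ ρ δ) (hδ : δ ≤ θ) (hθ : θ ≤ 1 / 4)
    (hθ0 : 0 ≤ θ) (hu : ‖u‖ = 1) (hun : ‖u - n₀‖ ≤ θ) {y : E} {s t : ℝ} (hst : s < t)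
    (hs : s • u + y ∈ Metric.ball x₀ (2 * ρ)) (ht : t • u + y ∈ Metric.ball x₀ (2 * ρ)) :
    φ (s • u + y) < φ (t • u + y) := by
  have h1 := h.approx _ ht _ hs
  have e : t • u + y - (s • u + y) = (t - s) • u := by module
  rw [e, inner_smul_right, norm_smul, hu, mul_one, Real.norm_eq_abs, abs_of_pos (sub_pos.2 hst),
    abs_le] at h1
  have h2 := h.inner_ge hu hun
  have : 0 < (t - s) * (⟪n₀, u⟫ - δ) := mul_pos (sub_pos.2 hst) (by nlinarith)
  nlinarith

/-- Moving from `x` slightly in direction `-n₀` makes `φ` strictly negative. -/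
theorem mem_closure (h : IsAlmostHalfSpace Ω φ x₀ n₀ ρ δ) (hδ : δ ≤ 1 / 4)
    {x : E} (hx : x ∈ Metric.ball x₀ (2 * ρ)) (h0 : φ x ≤ 0) : x ∈ closure Ω := by
  have hc : Filter.Tendsto (fun s : ℝ => s • n₀ + x) (nhdsWithin 0 (Iio 0)) (nhds x) := by
    have : Continuous fun s : ℝ => s • n₀ + x := by fun_prop
    simpa using (this.tendsto 0).mono_left nhdsWithin_le_nhds
  refine mem_closure_of_tendsto hc ?_
  filter_upwards [hc (Metric.isOpen_ball.mem_nhds hx), self_mem_nhdsWithin] with s hs hs0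
  rw [h.mem_iff _ hs]
  have := h.lt_of_lt (u := n₀) (θ := 1 / 4) hδ le_rfl (by norm_num) h.norm_eq (by simp) (y := x)
    (s := s) (t := 0) hs0 hs (by simpa using hx)
  simp only [zero_smul, zero_add] at this
  exact this.trans_le h0

theorem eq_zero_of_mem_frontier (h : IsAlmostHalfSpace Ω φ x₀ n₀ ρ δ) (hΩ : IsOpen Ω)
    {x : E} (hx : x ∈ Metric.ball x₀ (2 * ρ)) (hf : x ∈ frontier Ω) : φ x = 0 := by
  rw [hΩ.frontier_eq] at hf
  refine le_antisymm ?_ (not_lt.1 fun h0 => hf.2 ((h.mem_iff x hx).2 h0))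
  by_contra! h0
  have hc := (h.continuousOn.continuousAt (Metric.isOpen_ball.mem_nhds hx)).eventually
    (lt_mem_nhds h0)
  obtain ⟨y, hy, hyΩ⟩ := mem_closure_iff_nhds.1 hf.1 _
    (Filter.inter_mem hc (Metric.isOpen_ball.mem_nhds hx))
  exact absurd ((h.mem_iff y hy.2).1 hyΩ) (not_lt.2 (le_of_lt hy.1))

theorem mem_frontier (h : IsAlmostHalfSpace Ω φ x₀ n₀ ρ δ) (hδ : δ ≤ 1 / 4) (hΩ : IsOpen Ω)
    {x : E} (hx : x ∈ Metric.ball x₀ (2 * ρ)) (h0 : φ x = 0) : x ∈ frontier Ω := by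
  rw [hΩ.frontier_eq]
  exact ⟨h.mem_closure hδ hx h0.le, fun hxΩ => ((h.mem_iff x hx).1 hxΩ).ne h0⟩

/-- Since `φ` vanishes at both points, `z = x - y` is almost orthogonal to `n₀`, so `|⟪u, z⟫| ≤
2θ‖z‖`, and Pythagoras bounds `‖z‖` by its projection. The distortion is quadratic in `θ`; a linear
error would not survive the later division by `θ`. -/
theorem dist_le_of_mem_frontier [FiniteDimensional ℝ E]
    (h : IsAlmostHalfSpace Ω φ x₀ n₀ ρ δ) (hΩ : IsOpen Ω) (hδ : δ ≤ θ)
    (hθ : θ ≤ 1 / 4) (hθ0 : 0 ≤ θ) (hu : ‖u‖ = 1) (hun : ‖u - n₀‖ ≤ θ) {x y : E}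
    (hx : x ∈ Metric.ball x₀ (2 * ρ)) (hy : y ∈ Metric.ball x₀ (2 * ρ))
    (hxf : x ∈ frontier Ω) (hyf : y ∈ frontier Ω) :
    dist x y ≤ (1 + 4 * θ ^ 2) * dist ((ℝ ∙ u)ᗮ.orthogonalProjectionOnto x)
      ((ℝ ∙ u)ᗮ.orthogonalProjectionOnto y) := by
  have h1 := h.approx x hx y hy
  rw [h.eq_zero_of_mem_frontier hΩ hx hxf, h.eq_zero_of_mem_frontier hΩ hy hyf, sub_self, zero_sub,
    abs_neg] at h1
  rw [dist_eq_norm, dist_eq_norm, ← map_sub]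
  set z := x - y
  have h2 : |⟪u, z⟫| ≤ 2 * θ * ‖z‖ := by
    have e : ⟪u, z⟫ = ⟪u - n₀, z⟫ + ⟪n₀, z⟫ := by rw [← inner_add_left]; simp
    have h3 : |⟪u - n₀, z⟫| ≤ θ * ‖z‖ :=
      (abs_real_inner_le_norm _ _).trans (by gcongr)
    have h4 : δ * ‖z‖ ≤ θ * ‖z‖ := by gcongr
    rw [e]
    refine (abs_add_le _ _).trans ?_
    linarith
  have h3 : ‖z‖ ^ 2 = ⟪u, z⟫ ^ 2 + ‖(ℝ ∙ u)ᗮ.orthogonalProjectionOnto z‖ ^ 2 := by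
    rw [Submodule.norm_sq_eq_add_norm_sq_projection z (ℝ ∙ u)]
    congr 1
    change ‖(ℝ ∙ u).starProjection z‖ ^ 2 = _
    rw [Submodule.starProjection_unit_singleton ℝ hu, norm_smul, hu, mul_one, Real.norm_eq_abs,
      sq_abs]
  have h4 : ⟪u, z⟫ ^ 2 ≤ (2 * θ * ‖z‖) ^ 2 := by
    rw [← sq_abs]; gcongr
  have hq : θ ^ 2 ≤ 1 / 16 := by nlinarith
  refine le_of_sq_le_sq ?_ (by positivity)
  have h5 : (1 - 4 * θ ^ 2) * ‖z‖ ^ 2 ≤ ‖(ℝ ∙ u)ᗮ.orthogonalProjectionOnto z‖ ^ 2 := by linarith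
  -- This is `1 / √(1 - 4θ²) ≤ 1 + 4θ²` in polynomial form, valid because `θ² ≤ 1/16`.
  have h6 : 1 ≤ (1 + 4 * θ ^ 2) ^ 2 * (1 - 4 * θ ^ 2) := by
    have : 0 ≤ θ ^ 2 := by positivity
    nlinarith [mul_nonneg this this]
  calc ‖z‖ ^ 2 ≤ (1 + 4 * θ ^ 2) ^ 2 * (1 - 4 * θ ^ 2) * ‖z‖ ^ 2 :=
        le_mul_of_one_le_left (by positivity) h6
    _ = (1 + 4 * θ ^ 2) ^ 2 * ((1 - 4 * θ ^ 2) * ‖z‖ ^ 2) := by ring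
    _ ≤ (1 + 4 * θ ^ 2) ^ 2 * ‖(ℝ ∙ u)ᗮ.orthogonalProjectionOnto z‖ ^ 2 := by gcongr
    _ = _ := by ring

end IsAlmostHalfSpace

end Local

section Lines

variable {E : Type*} [NormedAddCommGroup E] [InnerProductSpace ℝ E]

local notation "⟪" x ", " y "⟫" => inner ℝ x y

/-- `s₀` is the parameter of the foot of the perpendicular from `x₀`, and `D` is the distance from
`x₀` to the line. -/
theorem norm_sq_line {u : E} (hu : ‖u‖ = 1) (y x₀ : E) :
    ∃ s₀ D : ℝ, 0 ≤ D ∧ ∀ s : ℝ, ‖s • u + y - x₀‖ ^ 2 = (s - s₀) ^ 2 + D ^ 2 := by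
  refine ⟨⟪u, x₀ - y⟫, ‖y - x₀ + ⟪u, x₀ - y⟫ • u‖, norm_nonneg _, fun s => ?_⟩
  have e : s • u + y - x₀ = (s - ⟪u, x₀ - y⟫) • u + (y - x₀ + ⟪u, x₀ - y⟫ • u) := by module
  have h0 : ⟪(s - ⟪u, x₀ - y⟫) • u, y - x₀ + ⟪u, x₀ - y⟫ • u⟫ = 0 := by
    rw [inner_smul_left, inner_add_right, inner_smul_right, real_inner_self_eq_norm_sq, hu,
      ← neg_sub x₀ y, inner_neg_right]
    simp
  rw [e, norm_add_sq_real, h0, norm_smul, hu]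
  simp

theorem fderiv_eq_zero_of_notMem_tsupport {f : E → ℝ} {x : E} (hx : x ∉ tsupport f) :
    fderiv ℝ f x = 0 := by
  by_contra h
  exact hx (support_fderiv_subset ℝ h)

/-- The integral of a directional derivative along a line crossing an almost flat boundary. -/
theorem IsAlmostHalfSpace.integral_line {Ω : Set E} {φ : E → ℝ} {x₀ n₀ u : E} {ρ δ θ : ℝ}
    [MeasurableSpace E] [BorelSpace E] [CompleteSpace E]
    (h : IsAlmostHalfSpace Ω φ x₀ n₀ ρ δ) (hΩ : IsOpen Ω) (hδ : δ ≤ θ)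
    (hθ : θ ≤ 1 / 4) (hθ0 : 0 ≤ θ) (hu : ‖u‖ = 1) (hun : ‖u - n₀‖ ≤ θ)
    {f : E → ℝ} (hf : HasBoundedDerivOn Ω f) (hsupp : tsupport f ⊆ Metric.ball x₀ ρ) (y : E) :
    (∀ s : ℝ, s • u + y ∈ frontier Ω ∩ Metric.closedBall x₀ ρ →
      ∫ t : ℝ, Ω.indicator (fun x => fderiv ℝ f x u) (t • u + y) = f (s • u + y)) ∧
    ((∀ s : ℝ, s • u + y ∉ frontier Ω ∩ Metric.closedBall x₀ ρ) →
      ∫ t : ℝ, Ω.indicator (fun x => fderiv ℝ f x u) (t • u + y) = 0) := by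
  obtain ⟨s₀, D, hD, hline⟩ := norm_sq_line hu y x₀
  have hρ := h.pos
  have hzero : ∀ x, x ∉ Metric.ball x₀ ρ → f x = 0 := fun x hx =>
    image_eq_zero_of_notMem_tsupport fun hx' => hx (hsupp hx')
  have hdzero : ∀ x, x ∉ Metric.ball x₀ ρ → fderiv ℝ f x = 0 := fun x hx =>
    fderiv_eq_zero_of_notMem_tsupport fun hx' => hx (hsupp hx')
  rcases le_or_gt ρ D with hDρ | hDρ
  · have hout : ∀ s : ℝ, s • u + y ∉ Metric.ball x₀ ρ := by
      intro s hs
      rw [mem_ball_iff_norm] at hs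
      have := hline s
      nlinarith [sq_nonneg (s - s₀), norm_nonneg (s • u + y - x₀)]
    have : ∀ t : ℝ, Ω.indicator (fun x => fderiv ℝ f x u) (t • u + y) = 0 := by
      intro t
      simp [indicator, hdzero _ (hout t)]
    simp only [this, integral_zero]
    exact ⟨fun s _ => (hzero _ (hout s)).symm, fun _ => trivial⟩
  -- The segment of half-length `ρ` about the foot contains the chord of the `ρ`-ball and stays in
  -- the `2ρ`-ball, since `ρ² + D² < 4ρ²`. This is why the flatness hypotheses are required on the
  -- doubled ball.
  have hball : ∀ s ∈ Icc (s₀ - ρ) (s₀ + ρ), s • u + y ∈ Metric.ball x₀ (2 * ρ) := by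
    intro s hs
    rw [mem_ball_iff_norm]
    have := hline s
    have h1 : (s - s₀) ^ 2 ≤ ρ ^ 2 := sq_le_sq' (by linarith [hs.1]) (by linarith [hs.2])
    refine lt_of_pow_lt_pow_left₀ 2 (by positivity) ?_
    nlinarith
  have hball' : ∀ s, s • u + y ∈ Metric.closedBall x₀ ρ → s ∈ Icc (s₀ - ρ) (s₀ + ρ) := by
    intro s hs
    rw [mem_closedBall_iff_norm] at hs
    have := hline s
    have h1 : (s - s₀) ^ 2 ≤ ρ ^ 2 := by
      have : ‖s • u + y - x₀‖ ^ 2 ≤ ρ ^ 2 := by gcongr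
      nlinarith
    have h2 := abs_le_of_sq_le_sq' h1 hρ.le
    constructor <;> linarith [h2.1, h2.2]
  have hball'' : ∀ s, s ∉ Ioo (s₀ - ρ) (s₀ + ρ) → s • u + y ∉ Metric.ball x₀ ρ := by
    intro s hs hs'
    rw [mem_ball_iff_norm] at hs'
    have := hline s
    have h1 : (s - s₀) ^ 2 < ρ ^ 2 := by
      have : ‖s • u + y - x₀‖ ^ 2 < ρ ^ 2 := by gcongr
      nlinarith
    have h2 := abs_lt_of_sq_lt_sq' h1 hρ.le
    exact hs ⟨by linarith [h2.1], by linarith [h2.2]⟩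
  have hcont : Continuous fun s : ℝ => s • u + y := by fun_prop
  obtain ⟨g, hg, hneg, hpos, hg0⟩ := exists_sign_change (a := s₀ - ρ) (b := s₀ + ρ) (by linarith)
    (ψ := fun s => φ (s • u + y)) (h.continuousOn.comp hcont.continuousOn hball)
    (fun s hs t ht hst => h.lt_of_lt hδ hθ hθ0 hu hun hst (hball s hs) (hball t ht))
  have hgf : ∀ s, s • u + y ∈ frontier Ω ∩ Metric.closedBall x₀ ρ → s = g := by
    intro s hs
    have hsI := hball' s hs.2
    have h0 : φ (s • u + y) = 0 := h.eq_zero_of_mem_frontier hΩ (hball s hsI) hs.1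
    rcases lt_trichotomy s g with hlt | heq | hgt
    · exact absurd h0 (hneg s ⟨hsI.1, hlt⟩).ne
    · exact heq
    · exact absurd h0 (hpos s ⟨hgt, hsI.2⟩).ne'
  -- Either the change point is a true boundary point, which then lies outside the ball, or it is an
  -- endpoint of the segment, also outside the open ball.
  have hnot : (∀ s : ℝ, s • u + y ∉ frontier Ω ∩ Metric.closedBall x₀ ρ) → f (g • u + y) = 0 := by
    intro hs
    rcases hg0 with h0 | h0
    · refine hzero _ fun hb => hs g ⟨h.mem_frontier (hδ.trans hθ) hΩ (hball g hg) h0,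
        Metric.ball_subset_closedBall hb⟩
    · refine hzero _ (hball'' _ fun h1 => ?_)
      rcases h0 with h0 | h0
      · exact h1.1.ne' h0
      · exact h1.2.ne h0
  have ha0 : f ((s₀ - ρ) • u + y) = 0 := hzero _ (hball'' _ fun h1 => h1.1.ne rfl)
  have hmain : ∫ t : ℝ, Ω.indicator (fun x => fderiv ℝ f x u) (t • u + y) = f (g • u + y) := by
    have hΩIoo : ∀ s ∈ Ioo (s₀ - ρ) g, s • u + y ∈ Ω := fun s hs =>
      (h.mem_iff _ (hball s ⟨hs.1.le, hs.2.le.trans hg.2⟩)).2 (hneg s ⟨hs.1.le, hs.2⟩)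
    -- On the segment `Ω` is met exactly before `g`, and off the segment `f` vanishes. The parameter
    -- `g` itself is negligible for the integral.
    have e1 : ∀ t, t ≠ g → Ω.indicator (fun x => fderiv ℝ f x u) (t • u + y)
        = (Ioo (s₀ - ρ) g).indicator (fun s => fderiv ℝ f (s • u + y) u) t := by
      intro t htg
      by_cases ht : t ∈ Ioo (s₀ - ρ) g
      · rw [indicator_of_mem ht, indicator_of_mem (hΩIoo t ht)]
      · rw [indicator_of_notMem ht]
        by_cases ht' : t ∈ Ioo (s₀ - ρ) (s₀ + ρ)
        · have hgt : g < t := lt_of_le_of_ne (not_lt.1 fun h1 => ht ⟨ht'.1, h1⟩) htg.symm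
          refine indicator_of_notMem (fun h1 => ?_) _
          exact ((h.mem_iff _ (hball t ⟨ht'.1.le, ht'.2.le⟩)).1 h1).not_gt (hpos t ⟨hgt, ht'.2.le⟩)
        · simp [indicator, hdzero _ (hball'' t ht')]
    have e2 : ∫ t : ℝ, Ω.indicator (fun x => fderiv ℝ f x u) (t • u + y)
        = ∫ t in (s₀ - ρ)..g, fderiv ℝ f (t • u + y) u := by
      rw [intervalIntegral.integral_of_le hg.1, integral_Ioc_eq_integral_Ioo,
        ← integral_indicator measurableSet_Ioo]
      refine integral_congr_ae ?_
      filter_upwards [compl_mem_ae_iff.2 (measure_singleton g)] with t ht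
      exact e1 t ht
    rw [e2, intervalIntegral.integral_eq_sub_of_hasDerivAt_of_le (f := fun s => f (s • u + y)) hg.1,
      ha0, sub_zero]
    · rcases hg.1.eq_or_lt with heq | hlt
      · rw [← heq, Icc_self]; exact continuousOn_singleton _ _
      · refine hf.continuousOn.comp hcont.continuousOn fun s hs => ?_
        have : s ∈ closure (Ioo (s₀ - ρ) g) := by rwa [closure_Ioo hlt.ne]
        exact map_mem_closure (f := fun s : ℝ => s • u + y) hcont this hΩIoo
    · intro s hs
      have hd := (hf.differentiableOn.differentiableAt (hΩ.mem_nhds (hΩIoo s hs))).hasFDerivAt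
      have hl : HasDerivAt (fun s : ℝ => s • u + y) u s := by
        simpa using ((hasDerivAt_id s).smul_const u).add_const y
      exact hd.comp_hasDerivAt s hl
    · rw [intervalIntegrable_iff_integrableOn_Ioo_of_le hg.1]
      obtain ⟨M, hM⟩ := hf.bounded
      refine Measure.integrableOn_of_bounded (M := M) (by simp) ?_ ?_
      · have : Measurable fun x => fderiv ℝ f x u := measurable_fderiv_apply_const ℝ f u
        exact (this.comp hcont.measurable).aestronglyMeasurable
      · refine (ae_restrict_iff' measurableSet_Ioo).2 (.of_forall fun s hs => ?_)
        refine ((fderiv ℝ f _).le_opNorm u).trans ?_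
        rw [hu, mul_one]
        exact hM _ (hΩIoo s hs)
  refine ⟨fun s hs => ?_, fun hs => ?_⟩
  · rw [hmain, hgf s hs]
  · rw [hmain, hnot hs]

end Lines

theorem HasBoundedDerivOn.integrableOn_fderiv {E : Type*} [NormedAddCommGroup E] [NormedSpace ℝ E]
    [MeasurableSpace E] [OpensMeasurableSpace E] [CompleteSpace E] {μ : Measure E}
    {Ω : Set E} (hΩ : IsOpen Ω) (hfin : μ Ω < ⊤) {f : E → ℝ}
    (hf : HasBoundedDerivOn Ω f) (v : E) : IntegrableOn (fun x => fderiv ℝ f x v) Ω μ := by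
  obtain ⟨M, hM⟩ := hf.bounded
  refine Measure.integrableOn_of_bounded (M := M * ‖v‖) hfin.ne
    (measurable_fderiv_apply_const ℝ f v).aestronglyMeasurable ?_
  refine (ae_restrict_iff' hΩ.measurableSet).2 (.of_forall fun x hx => ?_)
  exact (fderiv ℝ f x).le_of_opNorm_le (hM x hx) v

theorem HasBoundedDerivOn.integrableOn_frontier {E : Type*} [NormedAddCommGroup E] [NormedSpace ℝ E]
    [MeasurableSpace E] [OpensMeasurableSpace E] {μ : Measure E} {Ω : Set E} {f : E → ℝ}
    (hΩ : IsCompact (closure Ω)) (hfin : μ (frontier Ω) < ⊤)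
    (hf : HasBoundedDerivOn Ω f) : IntegrableOn f (frontier Ω) μ := by
  have hc : IsCompact (frontier Ω) := hΩ.of_isClosed_subset isClosed_frontier frontier_subset_closure
  have hf' := hf.continuousOn.mono (frontier_subset_closure (s := Ω))
  obtain ⟨M, hM⟩ := hc.exists_bound_of_continuousOn hf'
  exact IntegrableOn.of_bound hfin
    (hf'.aestronglyMeasurable_of_isCompact hc isClosed_frontier.measurableSet) M
    ((ae_restrict_iff' isClosed_frontier.measurableSet).2 (.of_forall hM))

/-- The chord of the convex function `(1 + x) ^ m` over `[0, 1]`. It turns the distortion `(1 + 4θ²)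
^ m` into `1 + O(θ²)`. -/
theorem one_add_pow_le {x : ℝ} (h0 : 0 ≤ x) (h1 : x ≤ 1) (m : ℕ) :
    (1 + x) ^ m ≤ 1 + (2 ^ m - 1) * x := by
  induction m with
  | zero => simp
  | succ m ih =>
    have h2 : (1 : ℝ) ≤ 2 ^ m := one_le_pow₀ (by norm_num)
    calc (1 + x) ^ (m + 1) = (1 + x) ^ m * (1 + x) := pow_succ _ _
      _ ≤ (1 + (2 ^ m - 1) * x) * (1 + x) := by gcongr
      _ ≤ 1 + (2 ^ (m + 1) - 1) * x := by
        rw [pow_succ]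
        nlinarith [mul_nonneg (mul_nonneg (sub_nonneg.2 h2) h0) (sub_nonneg.2 h1)]

section Transversal

variable {E : Type*} [NormedAddCommGroup E] [InnerProductSpace ℝ E] [FiniteDimensional ℝ E]
  [MeasurableSpace E] [BorelSpace E]

/-- Integrating a derivative in a direction close to the normal of an almost flat boundary yields
the surface integral up to an error of second order in the angle. -/
theorem IsAlmostHalfSpace.abs_integral_fderiv_sub_le {m : ℕ}
    [Fact (Module.finrank ℝ E = m + 1)] {Ω : Set E} {φ : E → ℝ}
    {x₀ n₀ u : E} {ρ δ θ : ℝ}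
    (h : IsAlmostHalfSpace Ω φ x₀ n₀ ρ δ) (hΩ : IsOpen Ω) (hb : Bornology.IsBounded Ω)
    (hδ : δ ≤ θ)
    (hθ : θ ≤ 1 / 4) (hθ0 : 0 ≤ θ) (hu : ‖u‖ = 1) (hun : ‖u - n₀‖ ≤ θ)
    {f : E → ℝ} (hf : HasBoundedDerivOn Ω f) (hsupp : tsupport f ⊆ Metric.ball x₀ ρ) :
    |(∫ x in Ω, fderiv ℝ f x u) - ∫ x in frontier Ω, f x ∂μHE[m]|
      ≤ 4 * 2 ^ m * θ ^ 2 * ∫ x in frontier Ω, |f x| ∂μHE[m] := by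
  have hu0 : u ≠ 0 := by rintro rfl; simp at hu
  have hcl : IsCompact (closure Ω) := hb.isCompact_closure
  set F := (ℝ ∙ u)ᗮ
  set π := F.orthogonalProjectionOnto
  set S := frontier Ω ∩ Metric.closedBall x₀ ρ
  have hScl : IsClosed S := isClosed_frontier.inter Metric.isClosed_closedBall
  have hScpt : IsCompact S :=
    hcl.of_isClosed_subset hScl (inter_subset_left.trans frontier_subset_closure)
  set h' : E → ℝ := Ω.indicator fun x => fderiv ℝ f x u
  set I : F → ℝ := fun y => ∫ t : ℝ, h' (t • u + y)
  have hint : Integrable h' :=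
    (integrable_indicator_iff hΩ.measurableSet).2
      (hf.integrableOn_fderiv hΩ ((measure_mono subset_closure).trans_lt hcl.measure_lt_top) u)
  have hIint : Integrable I := integrable_slice hu hint
  have hpdec : ∀ x : E, (inner ℝ u x) • u + (π x : E) = x := by
    intro x
    have h1 := (ℝ ∙ u).starProjection_add_starProjection_orthogonal x
    rwa [Submodule.starProjection_unit_singleton ℝ hu] at h1
  have hπ : ∀ (s : ℝ) (y : F), π (s • u + y) = y := by
    intro s y
    have hu' : π u = 0 :=
      Submodule.orthogonalProjectionOnto_orthogonal_apply_eq_zero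
        (Submodule.mem_span_singleton_self u)
    rw [map_add, map_smul, hu', smul_zero, zero_add]
    exact Submodule.orthogonalProjectionOnto_mem_subspace_eq_self y
  -- The boundary piece `S` is a graph over its projection, so the line integral `I` is `f` read off
  -- at the point of `S` above `y`, and zero where there is none.
  have hI1 : ∀ x ∈ S, I (π x) = f x := by
    intro x hx
    have := (h.integral_line hΩ hδ hθ hθ0 hu hun hf hsupp (π x : E)).1 (inner ℝ u x)
    rw [hpdec] at this
    exact this hx
  have hI2 : ∀ y, y ∉ π '' S → I y = 0 := by
    intro y hy
    refine (h.integral_line hΩ hδ hθ hθ0 hu hun hf hsupp (y : E)).2 fun s hs => hy ⟨_, hs, hπ s y⟩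
  have hvol : (μHE[m] : Measure F) = volume := by
    have : Module.finrank ℝ F = m := Submodule.finrank_orthogonal_span_singleton hu0
    rw [← InnerProductSpace.euclideanHausdorffMeasure_eq_volume, this]
  have hlip : LipschitzWith 1 π := by
    refine LipschitzWith.of_dist_le_mul fun x y => ?_
    rw [dist_eq_norm, dist_eq_norm, ← map_sub, NNReal.coe_one, one_mul]
    simpa using π.le_of_opNorm_le F.orthogonalProjectionOnto_norm_le (x - y)
  have hSball : ∀ x ∈ S, x ∈ Metric.ball x₀ (2 * ρ) := fun x hx =>
    Metric.closedBall_subset_ball (by linarith [h.pos]) hx.2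
  set K : NNReal := ⟨1 + 4 * θ ^ 2, by positivity⟩
  obtain ⟨hc1, hc2⟩ := compare_map_restrict (m := m) (K := K) (S := S) hlip fun x hx y hy =>
    h.dist_le_of_mem_frontier hΩ hδ hθ hθ0 hu hun (hSball x hx) (hSball y hy) hx.1 hy.1
  set ε := (2 ^ m - 1) * (4 * θ ^ 2)
  have h2m : (1 : ℝ) ≤ 2 ^ m := one_le_pow₀ (by norm_num)
  have hε : 0 ≤ ε := mul_nonneg (by linarith) (by positivity)
  have hK : (K : ENNReal) ^ m ≤ ENNReal.ofReal (1 + ε) := by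
    have : ENNReal.ofReal (1 + 4 * θ ^ 2) = (K : ENNReal) :=
      ENNReal.ofReal_eq_coe_nnreal (by positivity)
    rw [← this, ← ENNReal.ofReal_pow (by positivity)]
    exact ENNReal.ofReal_le_ofReal (one_add_pow_le (by positivity) (by nlinarith) m)
  have hc3 : ((μHE[m] : Measure E).restrict S).map π
      ≤ ENNReal.ofReal (1 + ε) • (μHE[m] : Measure F).restrict (π '' S) := by
    refine hc2.trans (Measure.le_iff.2 fun s _ => ?_)
    simp only [Measure.smul_apply, smul_eq_mul]
    gcongr
  have hπm : Measurable π := hlip.continuous.measurable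
  set ν := ((μHE[m] : Measure E).restrict S).map π
  have hIν : Integrable I ν := by
    have : Integrable I ((μHE[m] : Measure F).restrict (π '' S)) := by
      rw [hvol]; exact hIint.restrict
    exact (this.smul_measure ENNReal.ofReal_ne_top).mono_measure hc3
  have hkey := abs_integral_sub_integral_le hε hc1 hc3 hIν
  -- Used with `g = id` for the surface integral of `f` and with `g = |·|` for the error term.
  have hmapI : ∀ g : ℝ → ℝ, Continuous g → g 0 = 0 →
      ∫ y, g (I y) ∂ν = ∫ x in frontier Ω, g (f x) ∂μHE[m] := by
    intro g hg hg0
    rw [integral_map hπm.aemeasurable (hg.comp_aestronglyMeasurable hIν.aestronglyMeasurable)]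
    rw [setIntegral_congr_fun (g := fun x => g (f x)) hScl.measurableSet
      fun x hx => by simp only [hI1 x hx]]
    refine (setIntegral_eq_of_subset_of_forall_sdiff_eq_zero isClosed_frontier.measurableSet
      inter_subset_left fun x hx => ?_).symm
    rw [image_eq_zero_of_notMem_tsupport (f := f) fun hx' =>
      hx.2 ⟨hx.1, Metric.ball_subset_closedBall (hsupp hx')⟩, hg0]
  have e1 : ∫ x in Ω, fderiv ℝ f x u = ∫ y in π '' S, I y ∂μHE[m] := by
    rw [← integral_indicator hΩ.measurableSet, integral_eq_integral_slice hu hint, hvol,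
      setIntegral_eq_integral_of_forall_compl_eq_zero hI2]
  have e2 := hmapI id continuous_id rfl
  have e3 := hmapI abs continuous_abs abs_zero
  simp only [id] at e2
  rw [e1, ← e2, ← e3, abs_sub_comm]
  refine hkey.trans ?_
  gcongr
  simp only [ε]
  nlinarith [sq_nonneg θ]

end Transversal

/-! ### The outer normal: independence of the defining function, continuity, measurability. -/

section Normal

variable {d : ℕ} {Ω : Set (Space d)}

local notation "⟪" x ", " y "⟫" => inner ℝ x y

theorem hasDerivAt_comp_line {φ : Space d → ℝ} {x : Space d} (h : DifferentiableAt ℝ φ x)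
    (v : Space d) : HasDerivAt (fun s : ℝ => φ (x + s • v)) ⟪gradient φ x, v⟫ 0 := by
  have h1 : HasFDerivAt φ (fderiv ℝ φ x) (x + (0 : ℝ) • v) := by simpa using h.hasFDerivAt
  have hl : HasDerivAt (fun s : ℝ => x + s • v) v 0 := by
    simpa using ((hasDerivAt_id (0 : ℝ)).smul_const v).const_add x
  have := h1.comp_hasDerivAt (0 : ℝ) hl
  have e : ⟪gradient φ x, v⟫ = fderiv ℝ φ x v := by
    rw [gradient, InnerProductSpace.toDual_symm_apply]
  rwa [e]

theorem eventually_neg_of_hasDerivAt_neg {h : ℝ → ℝ} {h' : ℝ} (hd : HasDerivAt h h' 0)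
    (h0 : h 0 = 0) (hneg : h' < 0) : ∀ᶠ s in nhdsWithin (0 : ℝ) (Ioi 0), h s < 0 := by
  have h1 := (hasDerivAt_iff_tendsto_slope.1 hd).mono_left
    (nhdsWithin_mono 0 (fun s (hs : s ∈ Ioi (0 : ℝ)) => (ne_of_gt hs : s ≠ 0)))
  filter_upwards [h1.eventually (gt_mem_nhds hneg), self_mem_nhdsWithin] with s hs hs0
  rw [slope_def_field, h0, sub_zero, sub_zero] at hs
  by_contra! hc
  exact absurd hs (not_lt.2 (div_nonneg hc (le_of_lt hs0)))

namespace IsLocalDefiningFunction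

variable {φ ψ : Space d → ℝ} {x : Space d}

theorem differentiableAt (h : IsLocalDefiningFunction Ω φ x) : DifferentiableAt ℝ φ x :=
  h.contDiffAt.differentiableAt one_ne_zero

/-- A direction with negative `φ`-derivative enters `Ω`, whereas a positive `ψ`-derivative would
make it leave. -/
theorem inner_gradient_nonpos (hφ : IsLocalDefiningFunction Ω φ x)
    (hψ : IsLocalDefiningFunction Ω ψ x) {v : Space d} (hv : ⟪gradient φ x, v⟫ < 0) :
    ⟪gradient ψ x, v⟫ ≤ 0 := by
  by_contra! hc
  have h1 := eventually_neg_of_hasDerivAt_neg (hasDerivAt_comp_line hφ.differentiableAt v)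
    (by simpa using hφ.eq_zero) hv
  have h2 := eventually_neg_of_hasDerivAt_neg (hasDerivAt_comp_line hψ.differentiableAt v).neg
    (by simpa using hψ.eq_zero) (neg_neg_of_pos hc)
  have hl : Filter.Tendsto (fun s : ℝ => x + s • v) (nhdsWithin 0 (Ioi 0)) (nhds x) := by
    have : Continuous fun s : ℝ => x + s • v := by fun_prop
    simpa using (this.tendsto 0).mono_left nhdsWithin_le_nhds
  obtain ⟨s, h1, h2, h3, h4⟩ := (h1.and (h2.and ((hl.eventually hφ.eventually_mem_iff).and
    (hl.eventually hψ.eventually_mem_iff)))).exists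
  have := h4.1 (h3.2 h1)
  simp only [Pi.neg_apply] at h2
  linarith

/-- If the unit vectors `p` and `q` differed, the direction `q - p` would strictly decrease `φ` and
strictly increase `ψ`. Consequently the choice made in `outerNormal` is immaterial. -/
theorem normalized_gradient_eq (hφ : IsLocalDefiningFunction Ω φ x)
    (hψ : IsLocalDefiningFunction Ω ψ x) :
    ‖gradient φ x‖⁻¹ • gradient φ x = ‖gradient ψ x‖⁻¹ • gradient ψ x := by
  set p := ‖gradient φ x‖⁻¹ • gradient φ x with hp
  set q := ‖gradient ψ x‖⁻¹ • gradient ψ x with hq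
  have hφ0 : 0 < ‖gradient φ x‖⁻¹ := inv_pos.2 (norm_pos_iff.2 hφ.gradient_ne_zero)
  have hψ0 : 0 < ‖gradient ψ x‖⁻¹ := inv_pos.2 (norm_pos_iff.2 hψ.gradient_ne_zero)
  have hp1 : ‖p‖ = 1 := norm_smul_inv_norm hφ.gradient_ne_zero
  have hq1 : ‖q‖ = 1 := norm_smul_inv_norm hψ.gradient_ne_zero
  by_contra hpq
  have hlt : ⟪p, q⟫ < 1 := inner_lt_one_iff_real_of_norm_eq_one hp1 hq1 |>.2 hpq
  have h1 : ⟪p, q - p⟫ < 0 := by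
    rw [inner_sub_right, real_inner_self_eq_norm_sq, hp1]; linarith
  have h2 : 0 < ⟪q, q - p⟫ := by
    rw [inner_sub_right, real_inner_self_eq_norm_sq, hq1, real_inner_comm]; linarith
  rw [hp, real_inner_smul_left, ← hp] at h1
  rw [hq, real_inner_smul_left, ← hq] at h2
  exact absurd (hφ.inner_gradient_nonpos hψ (by nlinarith)) (not_le.2 (by
    by_contra! hc; nlinarith))

theorem outerNormal_eq (hφ : IsLocalDefiningFunction Ω φ x) :
    outerNormal Ω x = ‖gradient φ x‖⁻¹ • gradient φ x := by
  have h : ∃ ν, IsOuterUnitNormal Ω x ν := ⟨_, φ, hφ, rfl⟩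
  rw [outerNormal, dif_pos h]
  obtain ⟨ψ, hψ, e⟩ := h.choose_spec
  rw [e, hψ.normalized_gradient_eq hφ]

theorem continuousAt_gradient (hφ : ContDiffAt ℝ 1 φ x) : ContinuousAt (gradient φ) x := by
  have : ContinuousAt (fderiv ℝ φ) x := (hφ.fderiv_right (m := 0) (by norm_num)).continuousAt
  exact (InnerProductSpace.toDual ℝ (Space d)).symm.continuous.continuousAt.comp this

theorem eventually (hφ : IsLocalDefiningFunction Ω φ x) :
    ∀ᶠ y in nhds x, φ y = 0 → IsLocalDefiningFunction Ω φ y := by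
  have h1 := hφ.contDiffAt.eventually (by simp)
  have h2 := (continuousAt_gradient hφ.contDiffAt).eventually_ne hφ.gradient_ne_zero
  filter_upwards [h1, h2, hφ.eventually_mem_iff.eventually_nhds] with y h1 h2 h3 h4
  exact ⟨h1, h4, h2, h3⟩

/-- Strict differentiability bounds the nonlinear part of `φ` by a small Lipschitz constant near
`x`; dividing by `‖gradient φ x‖` normalizes the linear part. -/
theorem isAlmostHalfSpace (hφ : IsLocalDefiningFunction Ω φ x) {θ : ℝ} (hθ : 0 < θ) :
    ∀ᶠ ρ in nhdsWithin (0 : ℝ) (Ioi 0),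
      IsAlmostHalfSpace Ω (fun y => ‖gradient φ x‖⁻¹ * φ y) x (outerNormal Ω x) ρ θ := by
  have hG : 0 < ‖gradient φ x‖ := norm_pos_iff.2 hφ.gradient_ne_zero
  have hs := hφ.contDiffAt.hasStrictFDerivAt one_ne_zero
  have h1 := hs.isLittleO.def (mul_pos hθ hG)
  obtain ⟨r, hr, h1⟩ := Metric.eventually_nhds_iff_ball.1 h1
  obtain ⟨r', hr', h2⟩ := Metric.eventually_nhds_iff_ball.1 hφ.eventually_mem_iff
  have hlim : ∀ᶠ ρ in nhdsWithin (0 : ℝ) (Ioi 0), ρ < min r r' / 2 :=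
    nhdsWithin_le_nhds (Iio_mem_nhds (by positivity))
  filter_upwards [hlim, self_mem_nhdsWithin] with ρ hρ hρ0
  have hρr : 2 * ρ ≤ r := by linarith [min_le_left r r']
  have hρr' : 2 * ρ ≤ r' := by linarith [min_le_right r r']
  refine ⟨hρ0, ?_, fun y hy => ?_, fun y hy z hz => ?_⟩
  · rw [hφ.outerNormal_eq]; exact norm_smul_inv_norm hφ.gradient_ne_zero
  · rw [h2 y (Metric.ball_subset_ball hρr' hy)]
    refine ⟨mul_neg_of_pos_of_neg (inv_pos.2 hG), fun h => ?_⟩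
    by_contra! hc
    exact absurd h (not_lt.2 (mul_nonneg (inv_pos.2 hG).le hc))
  · have h3 := h1 (y, z) (by
      rw [← ball_prod_same]
      exact ⟨Metric.ball_subset_ball hρr hy, Metric.ball_subset_ball hρr hz⟩)
    have e : inner ℝ (gradient φ x) (y - z) = fderiv ℝ φ x (y - z) := by
      rw [gradient, InnerProductSpace.toDual_symm_apply]
    rw [hφ.outerNormal_eq, real_inner_smul_left, e, ← mul_sub, ← mul_sub, abs_mul,
      abs_of_pos (inv_pos.2 hG), inv_mul_le_iff₀ hG]
    rw [Real.norm_eq_abs] at h3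
    linarith

end IsLocalDefiningFunction

theorem norm_outerNormal {x : Space d} (hx : IsRegularBoundaryPoint Ω x) :
    ‖outerNormal Ω x‖ = 1 := by
  obtain ⟨φ, hφ⟩ := hx
  rw [hφ.outerNormal_eq]
  exact norm_smul_inv_norm hφ.gradient_ne_zero

theorem norm_outerNormal_le (x : Space d) : ‖outerNormal Ω x‖ ≤ 1 := by
  by_cases hx : ∃ ν, IsOuterUnitNormal Ω x ν
  · obtain ⟨ν, φ, hφ, -⟩ := hx
    exact (norm_outerNormal ⟨φ, hφ⟩).le
  · rw [outerNormal, dif_neg hx]; simp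

/-- All boundary points near a regular one are regular, and the outer normal is continuous there. -/
theorem IsRegularBoundaryPoint.eventually (hΩ : IsOpen Ω) {x : Space d}
    (hx : IsRegularBoundaryPoint Ω x) {θ : ℝ} (hθ : 0 < θ) :
    ∀ᶠ y in nhds x, y ∈ frontier Ω →
      IsRegularBoundaryPoint Ω y ∧ ‖outerNormal Ω y - outerNormal Ω x‖ ≤ θ := by
  obtain ⟨φ, hφ⟩ := hx
  have hG : 0 < ‖gradient φ x‖ := norm_pos_iff.2 hφ.gradient_ne_zero
  obtain ⟨ρ, hρ⟩ := (hφ.isAlmostHalfSpace hθ).exists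
  have hc : ContinuousAt (fun y => ‖gradient φ y‖⁻¹ • gradient φ y) x := by
    have := IsLocalDefiningFunction.continuousAt_gradient hφ.contDiffAt
    exact (this.norm.inv₀ hG.ne').smul this
  have hc' := Metric.continuousAt_iff'.1 hc θ hθ
  filter_upwards [hφ.eventually, hc', Metric.ball_mem_nhds x (mul_pos two_pos hρ.pos)]
    with y h1 h2 h3 h4
  have h0 := hρ.eq_zero_of_mem_frontier hΩ h3 h4
  have hφy := h1 ((mul_eq_zero_iff_left (inv_pos.2 hG).ne').1 h0)
  refine ⟨⟨φ, hφy⟩, ?_⟩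
  rw [hφy.outerNormal_eq, hφ.outerNormal_eq, ← dist_eq_norm]
  exact h2.le

/-- The regular points are relatively open in the frontier and the normal is continuous on them; the
remaining points are null. -/
theorem aestronglyMeasurable_outerNormal {μ : Measure (Space d)} (hΩ : IsOpen Ω)
    (hnull : μ {x ∈ frontier Ω | ¬ IsRegularBoundaryPoint Ω x} = 0) :
    AEStronglyMeasurable (outerNormal Ω) (μ.restrict (frontier Ω)) := by
  set R := {x ∈ frontier Ω | IsRegularBoundaryPoint Ω x}
  have hcont : ContinuousOn (outerNormal Ω) R := by
    intro x hx
    refine Metric.continuousWithinAt_iff'.2 fun ε hε => ?_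
    filter_upwards [nhdsWithin_le_nhds (hx.2.eventually hΩ (half_pos hε)), self_mem_nhdsWithin]
      with y hy hyR
    rw [dist_eq_norm]
    exact (hy hyR.1).2.trans_lt (half_lt_self hε)
  have hR : MeasurableSet R := by
    have : R = frontier Ω ∩ interior {y | y ∈ frontier Ω → IsRegularBoundaryPoint Ω y} := by
      ext x
      refine ⟨fun hx => ⟨hx.1, mem_interior_iff_mem_nhds.2 ?_⟩, fun hx => ⟨hx.1, ?_⟩⟩
      · filter_upwards [hx.2.eventually hΩ one_pos] with y hy hyf using (hy hyf).1
      · exact interior_subset hx.2 hx.1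
    rw [this]
    exact isClosed_frontier.measurableSet.inter isOpen_interior.measurableSet
  have : μ.restrict (frontier Ω) = μ.restrict R := by
    refine Measure.restrict_congr_set ?_
    refine (ae_eq_set).2 ⟨?_, ?_⟩
    · convert hnull using 2
      ext x; simp [R]
    · convert measure_empty (μ := μ)
      ext x; simp +contextual [R]
  rw [this]
  exact hcont.aestronglyMeasurable hR

theorem isClosed_singular (hΩ : IsOpen Ω) :
    IsClosed {x ∈ frontier Ω | ¬ IsRegularBoundaryPoint Ω x} := by
  have : {x ∈ frontier Ω | ¬ IsRegularBoundaryPoint Ω x}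
      = frontier Ω \ interior {y | y ∈ frontier Ω → IsRegularBoundaryPoint Ω y} := by
    ext x
    refine ⟨fun hx => ⟨hx.1, fun h => hx.2 (interior_subset h hx.1)⟩, fun hx => ⟨hx.1, fun h => ?_⟩⟩
    refine hx.2 (mem_interior_iff_mem_nhds.2 ?_)
    filter_upwards [h.eventually hΩ one_pos] with y hy hyf using (hy hyf).1
  rw [this]
  exact isClosed_frontier.sdiff isOpen_interior

end Normal

/-! ### The Gauss-Green formula away from the singular part of the boundary. -/

section Defect

variable {m : ℕ} {Ω : Set (Space (m + 1))}

local notation "⟪" x ", " y "⟫" => inner ℝ x y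

/-- The difference between both sides of the Gauss-Green formula. -/
noncomputable def gaussDefect (Ω : Set (Space (m + 1))) (f : Space (m + 1) → ℝ)
    (v : Space (m + 1)) : ℝ :=
  (∫ x in Ω, fderiv ℝ f x v) - ∫ x in frontier Ω, f x * ⟪outerNormal Ω x, v⟫ ∂μHE[m]

theorem integrableOn_mul_inner_outerNormal (hΩ : IsOpen Ω) (hb : Bornology.IsBounded Ω)
    (hP : HasPiecewiseC1Boundary Ω) {f : Space (m + 1) → ℝ} (hf : HasBoundedDerivOn Ω f)
    (v : Space (m + 1)) :
    IntegrableOn (fun x => f x * ⟪outerNormal Ω x, v⟫) (frontier Ω) μHE[m] := by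
  have hfi : IntegrableOn f (frontier Ω) μHE[m] :=
    hf.integrableOn_frontier hb.isCompact_closure hP.finite
  have hn : AEStronglyMeasurable (outerNormal Ω) ((μHE[m]).restrict (frontier Ω)) :=
    aestronglyMeasurable_outerNormal hΩ hP.null_singular
  refine Integrable.mul_bdd (c := ‖v‖) hfi (hn.inner aestronglyMeasurable_const)
    (.of_forall fun x => ?_)
  refine (norm_inner_le_norm _ _).trans ?_
  exact mul_le_of_le_one_left (norm_nonneg _) (norm_outerNormal_le x)

theorem gaussDefect_lincomb (hΩ : IsOpen Ω) (hb : Bornology.IsBounded Ω)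
    (hP : HasPiecewiseC1Boundary Ω) {f : Space (m + 1) → ℝ} (hf : HasBoundedDerivOn Ω f)
    (a b : ℝ) (v w : Space (m + 1)) :
    gaussDefect Ω f (a • v + b • w) = a * gaussDefect Ω f v + b * gaussDefect Ω f w := by
  have hfin : volume Ω < ⊤ := hb.measure_lt_top
  have i1 := hf.integrableOn_fderiv hΩ hfin
  have i2 := integrableOn_mul_inner_outerNormal hΩ hb hP hf
  have e1 : ∫ x in Ω, fderiv ℝ f x (a • v + b • w)
      = a * (∫ x in Ω, fderiv ℝ f x v) + b * ∫ x in Ω, fderiv ℝ f x w := by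
    rw [← integral_const_mul, ← integral_const_mul,
      ← integral_add ((i1 v).const_mul a) ((i1 w).const_mul b)]
    simp
  have e2 : ∫ x in frontier Ω, f x * ⟪outerNormal Ω x, a • v + b • w⟫ ∂μHE[m]
      = a * (∫ x in frontier Ω, f x * ⟪outerNormal Ω x, v⟫ ∂μHE[m])
        + b * ∫ x in frontier Ω, f x * ⟪outerNormal Ω x, w⟫ ∂μHE[m] := by
    rw [← integral_const_mul, ← integral_const_mul,
      ← integral_add ((i2 v).const_mul a) ((i2 w).const_mul b)]
    congr with x
    rw [inner_add_right, inner_smul_right, inner_smul_right]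
    ring
  rw [gaussDefect, e1, e2, gaussDefect, gaussDefect]
  ring

/-- In a small ball around a regular boundary point the Gauss-Green formula holds up to a small
multiple of the surface integral. -/
theorem IsRegularBoundaryPoint.exists_abs_gaussDefect_le (hΩ : IsOpen Ω)
    (hb : Bornology.IsBounded Ω) (hP : HasPiecewiseC1Boundary Ω) {x₀ : Space (m + 1)}
    (hx₀ : IsRegularBoundaryPoint Ω x₀) {ε : ℝ} (hε : 0 < ε) {v : Space (m + 1)} (hv : ‖v‖ ≤ 1) :
    ∃ ρ > 0, ∀ f, HasBoundedDerivOn Ω f → tsupport f ⊆ Metric.ball x₀ ρ →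
      |gaussDefect Ω f v| ≤ ε * ∫ x in frontier Ω, |f x| ∂μHE[m] := by
  have : Fact (Module.finrank ℝ (Space (m + 1)) = m + 1) := ⟨by simp⟩
  set n₀ := outerNormal Ω x₀ with hn₀
  have hn₀1 : ‖n₀‖ = 1 := norm_outerNormal hx₀
  -- `4 * 2 ^ m` comes from the projection estimate and `2` from replacing `⟪outerNormal Ω x, u⟫` by
  -- `1`.
  set C : ℝ := 4 * 2 ^ m + 2 with hC
  have hC0 : 0 < C := by positivity
  set θ : ℝ := min (1 / 4) (ε / (12 * C)) with hθdef
  have hθ0 : 0 < θ := by positivity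
  have hθ : θ ≤ 1 / 4 := min_le_left _ _
  have hθε : 12 * C * θ ≤ ε := by
    have := min_le_right (1 / 4) (ε / (12 * C))
    rw [← hθdef, le_div_iff₀ (by positivity)] at this
    linarith
  obtain ⟨r, hr, hnear⟩ := Metric.eventually_nhds_iff_ball.1 (hx₀.eventually hΩ hθ0)
  obtain ⟨φ, hφ⟩ := hx₀
  obtain ⟨ρ, hρ, hρr⟩ := ((hφ.isAlmostHalfSpace hθ0).and
    (nhdsWithin_le_nhds (Iio_mem_nhds hr))).exists
  refine ⟨ρ, hρ.pos, fun f hf hsupp => ?_⟩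
  set N := ∫ x in frontier Ω, |f x| ∂μHE[m]
  have hN0 : 0 ≤ N := integral_nonneg fun x => abs_nonneg _
  have hfi : IntegrableOn f (frontier Ω) μHE[m] :=
    hf.integrableOn_frontier hb.isCompact_closure hP.finite
  have key : ∀ u : Space (m + 1), ‖u‖ = 1 → ‖u - n₀‖ ≤ θ →
      |gaussDefect Ω f u| ≤ C * θ ^ 2 * N := by
    intro u hu hun
    have h1 := hρ.abs_integral_fderiv_sub_le (m := m) hΩ hb le_rfl hθ hθ0.le hu hun hf hsupp
    -- For unit vectors `1 - ⟪n, u⟫ = ‖n - u‖² / 2`, and both `n` and `u` are within `θ` of `n₀`, so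
    -- this error is again quadratic.
    have h2 : |∫ x in frontier Ω, (f x - f x * ⟪outerNormal Ω x, u⟫) ∂μHE[m]| ≤ 2 * θ ^ 2 * N := by
      rw [← integral_const_mul]
      refine (abs_integral_le_integral_abs).trans ?_
      refine setIntegral_mono_on (hfi.sub (integrableOn_mul_inner_outerNormal hΩ hb hP hf u)).abs
        (hfi.abs.const_mul _) isClosed_frontier.measurableSet fun x hx => ?_
      by_cases hxs : x ∈ tsupport f
      · obtain ⟨hreg, hxn⟩ := hnear x (Metric.ball_subset_ball (le_of_lt hρr) (hsupp hxs)) hx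
        have hx1 := norm_outerNormal hreg
        have h3 := norm_sub_sq_real (outerNormal Ω x) u
        rw [hx1, hu] at h3
        have h4 : ‖outerNormal Ω x - u‖ ≤ 2 * θ := by
          have : outerNormal Ω x - u = (outerNormal Ω x - n₀) - (u - n₀) := by abel
          rw [this]
          refine (norm_sub_le _ _).trans ?_
          linarith
        have h5 : ‖outerNormal Ω x - u‖ ^ 2 ≤ (2 * θ) ^ 2 := by gcongr
        have h6 : 0 ≤ 1 - ⟪outerNormal Ω x, u⟫ := by nlinarith [sq_nonneg ‖outerNormal Ω x - u‖]
        rw [← mul_one_sub, abs_mul, abs_of_nonneg h6, mul_comm]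
        gcongr
        nlinarith
      · simp [image_eq_zero_of_notMem_tsupport hxs]
    rw [integral_sub hfi (integrableOn_mul_inner_outerNormal hΩ hb hP hf u)] at h2
    have e : gaussDefect Ω f u = ((∫ x in Ω, fderiv ℝ f x u) - ∫ x in frontier Ω, f x ∂μHE[m])
        + ((∫ x in frontier Ω, f x ∂μHE[m])
          - ∫ x in frontier Ω, f x * ⟪outerNormal Ω x, u⟫ ∂μHE[m]) := by
      rw [gaussDefect]; ring
    rw [e]
    refine (abs_add_le _ _).trans ((add_le_add h1 h2).trans (le_of_eq ?_))
    rw [hC]; ring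
  -- A tilt by `θ / 4` leaves room for normalization: the normalized `w` is still within `θ` of
  -- `n₀`.
  set w := n₀ + (θ / 4) • v
  have hw : ‖w - n₀‖ ≤ θ / 4 := by
    simp only [w, add_sub_cancel_left, norm_smul, Real.norm_eq_abs, abs_of_pos (by linarith : 0 < θ / 4)]
    exact mul_le_of_le_one_right (by positivity) hv
  have hw1 : |‖w‖ - 1| ≤ θ / 4 := by
    rw [← hn₀1]; exact (abs_norm_sub_norm_le _ _).trans hw
  rw [abs_le] at hw1
  have hwpos : 0 < ‖w‖ := by linarith
  have hu1 : ‖‖w‖⁻¹ • w‖ = 1 := norm_smul_inv_norm (norm_pos_iff.1 hwpos)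
  have hu2 : ‖‖w‖⁻¹ • w - n₀‖ ≤ θ := by
    have e : ‖w‖⁻¹ • w - n₀ = (‖w‖⁻¹ • w - w) + (w - n₀) := by abel
    have e2 : ‖‖w‖⁻¹ • w - w‖ = |1 - ‖w‖| := by
      have : ‖w‖⁻¹ • w - w = (1 - ‖w‖) • (‖w‖⁻¹ • w) := by
        rw [sub_smul, one_smul, smul_smul, mul_inv_cancel₀ hwpos.ne', one_smul]
      rw [this, norm_smul, hu1, mul_one, Real.norm_eq_abs]
    have h3 : |1 - ‖w‖| ≤ θ / 4 := by rw [abs_le]; constructor <;> linarith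
    rw [e]
    refine (norm_add_le _ _).trans ?_
    rw [e2]; linarith
  -- Writing `v` as a difference quotient of near-normal directions costs a factor `4 / θ` against
  -- errors `C θ² N`. With `‖w‖ ≤ 2` the total is `12 C θ N`, which explains the choice of `θ`.
  have hvdec : v = (4 / θ * ‖w‖) • (‖w‖⁻¹ • w) + (-(4 / θ)) • n₀ := by
    rw [smul_smul, mul_assoc, mul_inv_cancel₀ hwpos.ne', mul_one]
    simp only [w, smul_add, smul_smul]
    rw [div_mul_div_cancel₀ hθ0.ne', div_self (by norm_num : (4 : ℝ) ≠ 0)]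
    module
  have k1 := key _ hu1 hu2
  have k2 := key n₀ hn₀1 (by simpa using hθ0.le)
  rw [hvdec, gaussDefect_lincomb hΩ hb hP hf]
  refine (abs_add_le _ _).trans ?_
  rw [abs_mul _ (gaussDefect Ω f (‖w‖⁻¹ • w)), abs_mul _ (gaussDefect Ω f n₀), abs_neg,
    abs_of_pos (by positivity : 0 < 4 / θ),
    abs_of_pos (by positivity : 0 < 4 / θ * ‖w‖)]
  calc 4 / θ * ‖w‖ * |gaussDefect Ω f (‖w‖⁻¹ • w)| + 4 / θ * |gaussDefect Ω f n₀|
      ≤ 4 / θ * 2 * (C * θ ^ 2 * N) + 4 / θ * (C * θ ^ 2 * N) := by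
        gcongr
        linarith
    _ = 12 * C * θ * N := by field_simp; ring
    _ ≤ ε * N := by gcongr

end Defect

section Algebra

variable {E : Type*} [NormedAddCommGroup E] [NormedSpace ℝ E] {Ω : Set E} {f g : E → ℝ}

theorem HasBoundedDerivOn.add (hΩ : IsOpen Ω) (hf : HasBoundedDerivOn Ω f)
    (hg : HasBoundedDerivOn Ω g) : HasBoundedDerivOn Ω (fun x => f x + g x) := by
  obtain ⟨M, hM⟩ := hf.bounded
  obtain ⟨N, hN⟩ := hg.bounded
  refine ⟨hf.continuousOn.add hg.continuousOn, hf.differentiableOn.add hg.differentiableOn,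
    M + N, fun x hx => ?_⟩
  rw [fderiv_fun_add (hf.differentiableOn.differentiableAt (hΩ.mem_nhds hx))
    (hg.differentiableOn.differentiableAt (hΩ.mem_nhds hx))]
  exact (norm_add_le _ _).trans (add_le_add (hM x hx) (hN x hx))

theorem HasBoundedDerivOn.zero : HasBoundedDerivOn Ω (fun _ : E => (0 : ℝ)) :=
  ⟨continuousOn_const, differentiableOn_const _, 0, fun x _ => by simp⟩

theorem HasBoundedDerivOn.sum {ι : Type*} (hΩ : IsOpen Ω) {f : ι → E → ℝ} (s : Finset ι)
    (hf : ∀ i ∈ s, HasBoundedDerivOn Ω (f i)) :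
    HasBoundedDerivOn Ω (fun x => ∑ i ∈ s, f i x) := by
  classical
  induction s using Finset.induction_on with
  | empty => simpa using HasBoundedDerivOn.zero
  | insert a s ha ih =>
    simp only [Finset.sum_insert ha]
    exact (hf a (Finset.mem_insert_self a s)).add hΩ
      (ih fun i hi => hf i (Finset.mem_insert_of_mem hi))

theorem HasBoundedDerivOn.mul (hΩ : IsOpen Ω) (hc : IsCompact (closure Ω))
    (hf : HasBoundedDerivOn Ω f)
    (hg : HasBoundedDerivOn Ω g) : HasBoundedDerivOn Ω (fun x => f x * g x) := by
  obtain ⟨M, hM⟩ := hf.bounded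
  obtain ⟨N, hN⟩ := hg.bounded
  obtain ⟨M', hM'⟩ := hc.exists_bound_of_continuousOn hf.continuousOn
  obtain ⟨N', hN'⟩ := hc.exists_bound_of_continuousOn hg.continuousOn
  refine ⟨hf.continuousOn.mul hg.continuousOn, hf.differentiableOn.mul hg.differentiableOn,
    M' * N + N' * M, fun x hx => ?_⟩
  rw [fderiv_fun_mul (hf.differentiableOn.differentiableAt (hΩ.mem_nhds hx))
    (hg.differentiableOn.differentiableAt (hΩ.mem_nhds hx))]
  refine (norm_add_le _ _).trans ?_
  rw [norm_smul, norm_smul]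
  have h1 := hM' x (subset_closure hx)
  have h2 := hN' x (subset_closure hx)
  have h3 := (norm_nonneg _).trans h1
  have h4 := (norm_nonneg _).trans h2
  gcongr
  · exact hN x hx
  · exact hM x hx

theorem HasBoundedDerivOn.of_contDiff (hc : IsCompact (closure Ω)) (hf : ContDiff ℝ 1 f) :
    HasBoundedDerivOn Ω f := by
  obtain ⟨M, hM⟩ := hc.exists_bound_of_continuousOn
    (hf.continuous_fderiv one_ne_zero).continuousOn
  exact ⟨hf.continuous.continuousOn, (hf.differentiable one_ne_zero).differentiableOn,
    M, fun x hx => hM x (subset_closure hx)⟩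

end Algebra

section DefectAlgebra

variable {m : ℕ} {Ω : Set (Space (m + 1))} {f g : Space (m + 1) → ℝ}

theorem gaussDefect_congr (hΩ : IsOpen Ω) (h : EqOn f g (closure Ω)) (v : Space (m + 1)) :
    gaussDefect Ω f v = gaussDefect Ω g v := by
  rw [gaussDefect, gaussDefect]
  congr 1
  · refine setIntegral_congr_fun hΩ.measurableSet fun x hx => ?_
    have : f =ᶠ[nhds x] g := by
      filter_upwards [hΩ.mem_nhds hx] with y hy using h (subset_closure hy)
    simp only [this.fderiv_eq]
  · refine setIntegral_congr_fun isClosed_frontier.measurableSet fun x hx => ?_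
    simp only [h (frontier_subset_closure hx)]

theorem gaussDefect_add (hΩ : IsOpen Ω) (hb : Bornology.IsBounded Ω)
    (hP : HasPiecewiseC1Boundary Ω) (hf : HasBoundedDerivOn Ω f) (hg : HasBoundedDerivOn Ω g)
    (v : Space (m + 1)) :
    gaussDefect Ω (fun x => f x + g x) v = gaussDefect Ω f v + gaussDefect Ω g v := by
  have hfin : volume Ω < ⊤ := hb.measure_lt_top
  have e1 : ∫ x in Ω, fderiv ℝ (fun x => f x + g x) x v
      = (∫ x in Ω, fderiv ℝ f x v) + ∫ x in Ω, fderiv ℝ g x v := by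
    rw [← integral_add (hf.integrableOn_fderiv hΩ hfin v) (hg.integrableOn_fderiv hΩ hfin v)]
    refine setIntegral_congr_fun hΩ.measurableSet fun x hx => ?_
    rw [fderiv_fun_add (hf.differentiableOn.differentiableAt (hΩ.mem_nhds hx))
      (hg.differentiableOn.differentiableAt (hΩ.mem_nhds hx))]
    rfl
  have e2 : ∫ x in frontier Ω, (f x + g x) * inner ℝ (outerNormal Ω x) v ∂μHE[m]
      = (∫ x in frontier Ω, f x * inner ℝ (outerNormal Ω x) v ∂μHE[m])
        + ∫ x in frontier Ω, g x * inner ℝ (outerNormal Ω x) v ∂μHE[m] := by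
    rw [← integral_add (integrableOn_mul_inner_outerNormal hΩ hb hP hf v)
      (integrableOn_mul_inner_outerNormal hΩ hb hP hg v)]
    simp only [add_mul]
  rw [gaussDefect, e1, e2, gaussDefect, gaussDefect]
  ring

theorem gaussDefect_sum {ι : Type*} (hΩ : IsOpen Ω) (hb : Bornology.IsBounded Ω)
    (hP : HasPiecewiseC1Boundary Ω) {f : ι → Space (m + 1) → ℝ} (s : Finset ι)
    (hf : ∀ i ∈ s, HasBoundedDerivOn Ω (f i)) (v : Space (m + 1)) :
    gaussDefect Ω (fun x => ∑ i ∈ s, f i x) v = ∑ i ∈ s, gaussDefect Ω (f i) v := by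
  classical
  induction s using Finset.induction_on with
  | empty => simp [gaussDefect]
  | insert a s ha ih =>
    have h1 := fun i (hi : i ∈ s) => hf i (Finset.mem_insert_of_mem hi)
    simp only [Finset.sum_insert ha]
    rw [gaussDefect_add hΩ hb hP (hf a (Finset.mem_insert_self a s))
      (HasBoundedDerivOn.sum hΩ s h1), ih h1]

/-- Such an `f` is differentiable with compact support on the whole space, so its derivative
integrates to zero, by integration by parts against the constant `1`. On the frontier `f` vanishes.
-/
theorem gaussDefect_eq_zero_of_tsupport_subset_ball (hΩ : IsOpen Ω)
    (hf : HasBoundedDerivOn Ω f) {x₀ : Space (m + 1)} {ρ : ℝ}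
    (hρ : Metric.ball x₀ ρ ⊆ Ω) (hsupp : tsupport f ⊆ Metric.ball x₀ ρ) (v : Space (m + 1)) :
    gaussDefect Ω f v = 0 := by
  have hout : ∀ x, x ∉ Ω → x ∉ tsupport f := fun x hx hx' => hx (hρ (hsupp hx'))
  have hdiff : Differentiable ℝ f := by
    intro x
    by_cases hx : x ∈ tsupport f
    · exact hf.differentiableOn.differentiableAt (hΩ.mem_nhds (hρ (hsupp hx)))
    · have : f =ᶠ[nhds x] fun _ => 0 := notMem_tsupport_iff_eventuallyEq.1 hx
      exact (differentiableAt_const (0 : ℝ)).congr_of_eventuallyEq this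
  have hcs : HasCompactSupport f := by
    refine (isCompact_closedBall x₀ ρ).of_isClosed_subset (isClosed_tsupport f) ?_
    exact hsupp.trans Metric.ball_subset_closedBall
  have hball : volume (Metric.ball x₀ ρ) < ⊤ := measure_ball_lt_top
  have hi1 : Integrable (fun x => fderiv ℝ f x v) := by
    have h0 : HasBoundedDerivOn (Metric.ball x₀ ρ) f := by
      obtain ⟨M, hM⟩ := hf.bounded
      exact ⟨hdiff.continuous.continuousOn, hdiff.differentiableOn, M, fun x hx => hM x (hρ hx)⟩
    refine (integrableOn_iff_integrable_of_support_subset fun x hx => ?_).1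
      (h0.integrableOn_fderiv Metric.isOpen_ball hball v)
    refine hsupp ?_
    by_contra hx'
    exact hx (by simp [fderiv_eq_zero_of_notMem_tsupport hx'])
  have hi2 : Integrable f := hdiff.continuous.integrable_of_hasCompactSupport hcs
  have e1 : ∫ x in Ω, fderiv ℝ f x v = 0 := by
    rw [setIntegral_eq_integral_of_forall_compl_eq_zero fun x hx => by
      rw [fderiv_eq_zero_of_notMem_tsupport (hout x hx)]; rfl]
    have := integral_mul_fderiv_eq_neg_fderiv_mul_of_integrable (μ := volume) (𝕜 := ℝ)
      (f := fun _ : Space (m + 1) => (1 : ℝ)) (g := f) (v := v) (by simp)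
      (by simpa using hi1) (by simpa using hi2) (by fun_prop) (fun x _ => hdiff x)
    simpa using this
  have e2 : ∫ x in frontier Ω, f x * inner ℝ (outerNormal Ω x) v ∂μHE[m] = 0 := by
    refine setIntegral_eq_zero_of_forall_eq_zero fun x hx => ?_
    rw [hΩ.frontier_eq] at hx
    rw [image_eq_zero_of_notMem_tsupport (hout x hx.2), zero_mul]
  rw [gaussDefect, e1, e2, sub_zero]

end DefectAlgebra

section Global

variable {m : ℕ} {Ω : Set (Space (m + 1))} {f : Space (m + 1) → ℝ}

open scoped Manifold ContDiff

/-- The Gauss-Green formula for functions vanishing near the singular part of the boundary. -/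
theorem gaussDefect_eq_zero_of_tsupport_disjoint (hΩ : IsOpen Ω) (hb : Bornology.IsBounded Ω)
    (hP : HasPiecewiseC1Boundary Ω) (hf : HasBoundedDerivOn Ω f)
    (hsupp : ∀ x ∈ frontier Ω, x ∈ tsupport f → IsRegularBoundaryPoint Ω x)
    {v : Space (m + 1)} (hv : ‖v‖ ≤ 1) : gaussDefect Ω f v = 0 := by
  have hcl := hb.isCompact_closure
  set K := closure Ω ∩ tsupport f
  have hK : IsCompact K := hcl.inter_right (isClosed_tsupport f)
  have hfi : IntegrableOn f (frontier Ω) μHE[m] :=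
    hf.integrableOn_frontier hb.isCompact_closure hP.finite
  set N := ∫ x in frontier Ω, |f x| ∂μHE[m]
  have hN0 : 0 ≤ N := integral_nonneg fun x => abs_nonneg _
  suffices h : ∀ ε > 0, |gaussDefect Ω f v| ≤ ε * N by
    refine abs_eq_zero.1 (le_antisymm (le_of_forall_pos_le_add fun ε hε => ?_) (abs_nonneg _))
    refine (h (ε / (N + 1)) (by positivity)).trans ?_
    rw [zero_add, div_mul_eq_mul_div, div_le_iff₀ (by positivity)]
    nlinarith
  intro ε hε
  -- The bound is relative to `∫ |g|` rather than absolute, so the local errors will add up to `ε N`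
  -- however many balls the cover needs.
  have hloc : ∀ x, ∃ ρ > 0, x ∈ K → ∀ g, HasBoundedDerivOn Ω g → tsupport g ⊆ Metric.ball x ρ →
      |gaussDefect Ω g v| ≤ ε * ∫ x in frontier Ω, |g x| ∂μHE[m] := by
    intro x
    by_cases hx : x ∈ K
    swap
    · exact ⟨1, one_pos, fun h => absurd h hx⟩
    by_cases hxΩ : x ∈ Ω
    · obtain ⟨ρ, hρ, hρΩ⟩ := Metric.isOpen_iff.1 hΩ x hxΩ
      refine ⟨ρ, hρ, fun _ g hg hgs => ?_⟩
      rw [gaussDefect_eq_zero_of_tsupport_subset_ball hΩ hg hρΩ hgs, abs_zero]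
      exact mul_nonneg hε.le (integral_nonneg fun x => abs_nonneg _)
    · have hxf : x ∈ frontier Ω := by rw [hΩ.frontier_eq]; exact ⟨hx.1, hxΩ⟩
      obtain ⟨ρ, hρ, h⟩ := (hsupp x hxf hx.2).exists_abs_gaussDefect_le hΩ hb hP hε hv
      exact ⟨ρ, hρ, fun _ => h⟩
  choose ρ hρ hρK using hloc
  obtain ⟨t, htK, ht⟩ := hK.elim_nhds_subcover (fun x => Metric.ball x (ρ x))
    fun x _ => Metric.ball_mem_nhds x (hρ x)
  obtain ⟨χ, hχ⟩ := SmoothPartitionOfUnity.exists_isSubordinate 𝓘(ℝ, Space (m + 1)) hK.isClosed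
    (fun i : t => Metric.ball (i : Space (m + 1)) (ρ i)) (fun i => Metric.isOpen_ball)
    (by simpa [iUnion_subtype] using ht)
  have hχd : ∀ i, ContDiff ℝ 1 (χ i) := fun i => (χ i).contMDiff.contDiff.of_le (by norm_num)
  have hg : ∀ i, HasBoundedDerivOn Ω (fun x => χ i x * f x) := fun i =>
    (HasBoundedDerivOn.of_contDiff hcl (hχd i)).mul hΩ hcl hf
  have hsum : ∀ x ∈ closure Ω, ∑ i, χ i x * f x = f x := by
    intro x hx
    by_cases hxs : x ∈ tsupport f
    · have := χ.sum_eq_one (x := x) ⟨hx, hxs⟩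
      rw [finsum_eq_sum_of_fintype] at this
      rw [← Finset.sum_mul, this, one_mul]
    · simp [image_eq_zero_of_notMem_tsupport hxs]
  have e1 : gaussDefect Ω f v = ∑ i, gaussDefect Ω (fun x => χ i x * f x) v := by
    rw [← gaussDefect_sum hΩ hb hP _ fun i _ => hg i]
    exact gaussDefect_congr hΩ (fun x hx => (hsum x hx).symm) v
  rw [e1]
  refine (Finset.abs_sum_le_sum_abs _ _).trans ?_
  have hgi : ∀ i, IntegrableOn (fun x => χ i x * f x) (frontier Ω) μHE[m] := fun i =>
    (hg i).integrableOn_frontier hcl hP.finite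
  calc ∑ i, |gaussDefect Ω (fun x => χ i x * f x) v|
      ≤ ∑ i, ε * ∫ x in frontier Ω, |χ i x * f x| ∂μHE[m] := by
        refine Finset.sum_le_sum fun i _ => hρK i (htK i i.2) _ (hg i) ?_
        exact (tsupport_mul_subset_left (f := χ i) (g := f)).trans (hχ i)
    _ = ε * ∫ x in frontier Ω, ∑ i, |χ i x * f x| ∂μHE[m] := by
        rw [← Finset.mul_sum, integral_finsetSum _ fun i _ => (hgi i).abs]
    _ = ε * N := by
        congr 1
        refine setIntegral_congr_fun isClosed_frontier.measurableSet fun x hx => ?_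
        have h1 := congrArg abs (hsum x (frontier_subset_closure hx))
        rw [← Finset.sum_mul, abs_mul,
          abs_of_nonneg (Finset.sum_nonneg fun i _ => χ.nonneg i x)] at h1
        rw [← h1, Finset.sum_mul]
        exact Finset.sum_congr rfl fun i _ => by rw [abs_mul, abs_of_nonneg (χ.nonneg i x)]

end Global

/-! ### Removing the singular part of the boundary by cutoffs. -/

section Covering

/-- A compact set of vanishing `m`-dimensional Hausdorff measure is covered by finitely many small
balls centred in it, with arbitrarily small sum of the `m`-th powers of the radii. -/
theorem exists_finite_ball_cover {X : Type*} [MetricSpace X] [Nonempty X] [MeasurableSpace X]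
    [BorelSpace X] {m : ℕ} {Z : Set X} (hZ : IsCompact Z) (hnull : μHE[m] Z = 0) {ε : ℝ} (hε : 0 < ε) :
    ∃ (F : Finset ℕ) (c : ℕ → X) (r : ℕ → ℝ), (∀ n ∈ F, c n ∈ Z ∧ 0 < r n ∧ r n ≤ ε) ∧
      (Z ⊆ ⋃ n ∈ F, Metric.ball (c n) (r n)) ∧ ∑ n ∈ F, r n ^ m ≤ ε := by
  have hH : μH[m] Z = 0 := by
    rw [Measure.euclideanHausdorffMeasure_def, Measure.smul_apply, ENNReal.smul_def,
      smul_eq_mul, mul_eq_zero] at hnull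
    exact hnull.resolve_left (by
      simpa using Measure.addHaarScalarFactor_volume_hausdorffMeasure_ne_zero m)
  rw [Measure.hausdorffMeasure_apply] at hH
  have h1 : (⨅ (t : ℕ → Set X) (_ : Z ⊆ ⋃ n, t n)
      (_ : ∀ n, Metric.ediam (t n) ≤ ENNReal.ofReal (ε / 2)),
      ∑' n, ⨆ _ : (t n).Nonempty, Metric.ediam (t n) ^ (m : ℝ)) < ENNReal.ofReal (ε / 2) := by
    have := ENNReal.iSup_eq_zero.1 hH (ENNReal.ofReal (ε / 2))
    have := ENNReal.iSup_eq_zero.1 this (ENNReal.ofReal_pos.2 (half_pos hε))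
    rw [this]
    exact ENNReal.ofReal_pos.2 (half_pos hε)
  simp only [iInf_lt_iff] at h1
  obtain ⟨t, htZ, htd, hts⟩ := h1
  set D : ℕ → ℝ := fun n => (Metric.ediam (t n)).toReal
  have hDε : ∀ n, D n ≤ ε / 2 := fun n =>
    ENNReal.toReal_le_of_le_ofReal (half_pos hε).le (htd n)
  have hfin : ∀ n, Metric.ediam (t n) ≠ ⊤ := fun n =>
    ((htd n).trans_lt ENNReal.ofReal_lt_top).ne
  -- An open ball about a point of `t n` contains `t n` only if its radius exceeds the diameter. The
  -- excess in the `m`-th powers is a geometric series with sum `ε / 2`.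
  have hr : ∀ n, ∃ r, D n < r ∧ r ≤ ε ∧ r ^ m ≤ D n ^ m + ε / 2 / 2 / 2 ^ n := by
    intro n
    have hpos : 0 < ε / 2 / 2 / 2 ^ n := by positivity
    have hc : ContinuousAt (fun r : ℝ => r ^ m) (D n) := by fun_prop
    have h2 : ∀ᶠ r in nhdsWithin (D n) (Ioi (D n)), r ^ m < D n ^ m + ε / 2 / 2 / 2 ^ n :=
      nhdsWithin_le_nhds (hc.eventually (gt_mem_nhds (by linarith)))
    have h3 : ∀ᶠ r in nhdsWithin (D n) (Ioi (D n)), r < ε :=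
      nhdsWithin_le_nhds (gt_mem_nhds (by linarith [hDε n]))
    obtain ⟨r, h2, h3, h4⟩ := (h2.and (h3.and self_mem_nhdsWithin)).exists
    exact ⟨r, h4, h3.le, h2.le⟩
  choose r hrD hrε hrm using hr
  have hr0 : ∀ n, 0 < r n := fun n => ENNReal.toReal_nonneg.trans_lt (hrD n)
  rcases Z.eq_empty_or_nonempty with rfl | ⟨z, hz⟩
  · exact ⟨∅, fun _ => Classical.arbitrary X, r, by simp, by simp, by simpa using hε.le⟩
  have hcen : ∀ n, ∃ c ∈ Z, (t n ∩ Z).Nonempty → c ∈ t n := by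
    intro n
    by_cases h : (t n ∩ Z).Nonempty
    · exact ⟨h.some, h.some_mem.2, fun _ => h.some_mem.1⟩
    · exact ⟨z, hz, fun h' => absurd h' h⟩
  choose c hcZ hct using hcen
  have hsub : ∀ n, (t n ∩ Z) ⊆ Metric.ball (c n) (r n) := by
    intro n x hx
    rw [Metric.mem_ball, dist_edist]
    refine lt_of_le_of_lt ?_ (hrD n)
    exact ENNReal.toReal_mono (hfin n) (Metric.edist_le_ediam_of_mem hx.1 (hct n ⟨x, hx⟩))
  -- Only indices with `t n` meeting `Z` are kept: there the centre lies in `t n`, and the supremum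
  -- over nonemptiness in the Hausdorff sum equals the power of the diameter, also for `m = 0`.
  obtain ⟨F, hF⟩ := hZ.elim_finite_subcover_image (b := {n | (t n ∩ Z).Nonempty})
    (c := fun n => Metric.ball (c n) (r n)) (fun _ _ => Metric.isOpen_ball) (by
      intro x hx
      obtain ⟨n, hn⟩ := mem_iUnion.1 (htZ hx)
      exact mem_biUnion (show (t n ∩ Z).Nonempty from ⟨x, hn, hx⟩) (hsub n ⟨hn, hx⟩))
  obtain ⟨hFb, hFfin, hFc⟩ := hF
  refine ⟨hFfin.toFinset, c, r, fun n _ => ⟨hcZ n, hr0 n, hrε n⟩, by simpa using hFc, ?_⟩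
  have h5 : ∑ n ∈ hFfin.toFinset, D n ^ m ≤ ε / 2 := by
    have h6 : ∑ n ∈ hFfin.toFinset, Metric.ediam (t n) ^ m ≤ ENNReal.ofReal (ε / 2) := by
      refine le_trans (Finset.sum_le_sum fun n hn => ?_)
        ((ENNReal.sum_le_tsum hFfin.toFinset).trans hts.le)
      have hne : (t n).Nonempty := (hFb (hFfin.mem_toFinset.1 hn)).mono inter_subset_left
      simp [hne]
    have h7 := ENNReal.toReal_le_of_le_ofReal (half_pos hε).le h6
    rw [ENNReal.toReal_sum fun n _ => ENNReal.pow_ne_top (hfin n)] at h7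
    simpa [D, ENNReal.toReal_pow] using h7
  have h6 : ∑ n ∈ hFfin.toFinset, ε / 2 / 2 / 2 ^ n ≤ ε / 2 :=
    (summable_geometric_two' (ε / 2)).sum_le_tsum _ (fun n _ => by positivity) |>.trans
      (tsum_geometric_two' (ε / 2)).le
  calc ∑ n ∈ hFfin.toFinset, r n ^ m ≤ ∑ n ∈ hFfin.toFinset, (D n ^ m + ε / 2 / 2 / 2 ^ n) :=
        Finset.sum_le_sum fun n _ => hrm n
    _ ≤ ε := by rw [Finset.sum_add_distrib]; linarith

end Covering

section Cutoff

variable {m : ℕ}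

/-- By the product rule, with the remaining factors in `[0, 1]`. The total variation of the cutoff
is therefore at most the sum over the balls, with no constant depending on their number. -/
theorem norm_fderiv_prod_one_sub_le {ι E : Type*} [NormedAddCommGroup E] [NormedSpace ℝ E]
    (G : Finset ι) {ψ : ι → E → ℝ} (hψ : ∀ n, Differentiable ℝ (ψ n))
    (hb : ∀ n x, 0 ≤ 1 - ψ n x ∧ 1 - ψ n x ≤ 1) (x : E) :
    ‖fderiv ℝ (fun x => ∏ n ∈ G, (1 - ψ n x)) x‖ ≤ ∑ n ∈ G, ‖fderiv ℝ (ψ n) x‖ := by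
  classical
  have hd : ∀ n ∈ G, HasFDerivAt (fun x => 1 - ψ n x) (-fderiv ℝ (ψ n) x) x := fun n _ =>
    (hψ n x).hasFDerivAt.const_sub 1
  rw [(HasFDerivAt.finsetProd hd).fderiv]
  refine (norm_sum_le _ _).trans (Finset.sum_le_sum fun n hn => ?_)
  rw [smul_neg, norm_neg, norm_smul]
  refine mul_le_of_le_one_left (norm_nonneg _) ?_
  rw [Real.norm_eq_abs, abs_of_nonneg (Finset.prod_nonneg fun n _ => (hb n x).1)]
  exact Finset.prod_le_one (fun n _ => (hb n x).1) fun n _ => (hb n x).2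

/-- Cutoff functions vanishing near a compact null set, with small total variation. -/
theorem exists_cutoff {Z : Set (Space (m + 1))} (hZ : IsCompact Z) (hnull : μHE[m] Z = 0)
    {ε : ℝ} (hε : 0 < ε) :
    ∃ η : Space (m + 1) → ℝ, ContDiff ℝ 1 η ∧ (∀ x, 0 ≤ η x ∧ η x ≤ 1) ∧
      (∀ x ∈ Z, x ∉ tsupport η) ∧ (∀ x ∉ Metric.thickening ε Z, η x = 1) ∧
      ∫⁻ x, ‖fderiv ℝ η x‖ₑ ≤ ENNReal.ofReal ε := by
  let χ : ContDiffBump (0 : Space (m + 1)) := ⟨1, 2, one_pos, one_lt_two⟩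
  have hχ : ContDiff ℝ 1 χ := χ.contDiff
  have hχsupp : HasCompactSupport (fderiv ℝ χ) := χ.hasCompactSupport.fderiv ℝ
  obtain ⟨M, hM⟩ := (hχ.continuous_fderiv one_ne_zero).bounded_above_of_compact_support hχsupp
  have hM0 : 0 ≤ M := (norm_nonneg _).trans (hM 0)
  set V := (volume (Metric.ball (0 : Space (m + 1)) 1)).toReal
  -- The rescaled bump has gradient at most `M / r`, supported in a ball of volume `V (2 r) ^ (m +
  -- 1)`; the product is `C * r ^ m`.
  set C := M * 2 ^ (m + 1) * V
  have hC0 : 0 ≤ C := by positivity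
  -- `ε / 3` keeps the doubled balls inside the `ε`-thickening, and `ε / (C + 1)` makes `C` times
  -- the sum of the `r ^ m` at most `ε`.
  set ε' := min (ε / 3) (ε / (C + 1))
  have hε' : 0 < ε' := by positivity
  obtain ⟨F, c, r, hFr, hFc, hFs⟩ := exists_finite_ball_cover hZ hnull hε'
  set ψ : ℕ → Space (m + 1) → ℝ := fun n x => χ ((r n)⁻¹ • (x - c n))
  have hψ : ∀ n, ContDiff ℝ 1 (ψ n) := fun n => hχ.comp (by fun_prop)
  have hψ0 : ∀ n ∈ F, ∀ x, 2 * r n ≤ dist x (c n) → ψ n x = 0 := by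
    intro n hn x hx
    refine χ.zero_of_le_dist ?_
    rw [dist_zero_right, norm_smul, norm_inv, Real.norm_eq_abs, abs_of_pos (hFr n hn).2.1,
      ← dist_eq_norm, le_inv_mul_iff₀ (hFr n hn).2.1, mul_comm]
    exact hx
  have hψ1 : ∀ n ∈ F, ∀ x ∈ Metric.ball (c n) (r n), ψ n x = 1 := by
    intro n hn x hx
    refine χ.one_of_mem_closedBall ?_
    rw [mem_closedBall_zero_iff, norm_smul, norm_inv, Real.norm_eq_abs, abs_of_pos (hFr n hn).2.1,
      ← dist_eq_norm, inv_mul_le_iff₀ (hFr n hn).2.1, mul_one]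
    exact le_of_lt hx
  have hψd : ∀ n ∈ F, ∫⁻ x, ‖fderiv ℝ (ψ n) x‖ₑ ≤ ENNReal.ofReal (C * r n ^ m) := by
    intro n hn
    have hr := (hFr n hn).2.1
    have hbound : ∀ x, ‖fderiv ℝ (ψ n) x‖ ≤ (r n)⁻¹ * M := by
      intro x
      have h1 : HasFDerivAt (fun x : Space (m + 1) => (r n)⁻¹ • (x - c n))
          ((r n)⁻¹ • ContinuousLinearMap.id ℝ _) x :=
        ((hasFDerivAt_id x).sub_const (c n)).fun_const_smul _
      have h2 := ((hχ.differentiable one_ne_zero _).hasFDerivAt.comp x h1).fderiv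
      change ‖fderiv ℝ (χ ∘ fun x => (r n)⁻¹ • (x - c n)) x‖ ≤ _
      rw [h2, ContinuousLinearMap.comp_smul, ContinuousLinearMap.comp_id, norm_smul, norm_inv,
        Real.norm_eq_abs, abs_of_pos hr]
      gcongr
      exact hM _
    have hzero : ∀ x, x ∉ Metric.closedBall (c n) (2 * r n) → fderiv ℝ (ψ n) x = 0 := by
      intro x hx
      refine fderiv_eq_zero_of_notMem_tsupport fun hx' => hx ?_
      refine closure_minimal (fun y hy => ?_) Metric.isClosed_closedBall hx'
      by_contra hy'
      exact hy (hψ0 n hn y (le_of_not_ge hy'))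
    calc ∫⁻ x, ‖fderiv ℝ (ψ n) x‖ₑ
        ≤ ∫⁻ x, (Metric.closedBall (c n) (2 * r n)).indicator
            (fun _ => ENNReal.ofReal ((r n)⁻¹ * M)) x := by
          refine lintegral_mono fun x => ?_
          by_cases hx : x ∈ Metric.closedBall (c n) (2 * r n)
          · rw [indicator_of_mem hx, ← ofReal_norm]
            exact ENNReal.ofReal_le_ofReal (hbound x)
          · rw [← ofReal_norm, hzero x hx, norm_zero, ENNReal.ofReal_zero]; exact zero_le
      _ = ENNReal.ofReal ((r n)⁻¹ * M) * volume (Metric.closedBall (c n) (2 * r n)) := by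
          rw [lintegral_indicator_const Metric.isClosed_closedBall.measurableSet]
      _ = ENNReal.ofReal (C * r n ^ m) := by
          rw [Measure.addHaar_closedBall _ _ (by positivity), finrank_euclideanSpace_fin,
            ← ENNReal.ofReal_toReal (measure_ball_lt_top (μ := volume)
              (x := (0 : Space (m + 1))) (r := 1)).ne,
            ← ENNReal.ofReal_mul (by positivity), ← ENNReal.ofReal_mul (by positivity)]
          congr 1
          simp only [C, V]
          field_simp
          ring
  have hb : ∀ n x, 0 ≤ 1 - ψ n x ∧ 1 - ψ n x ≤ 1 := fun n x =>
    ⟨sub_nonneg.2 χ.le_one, sub_le_self _ χ.nonneg⟩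
  have h3 := norm_fderiv_prod_one_sub_le F (fun n => (hψ n).differentiable one_ne_zero) hb
  have h1 : ContDiff ℝ 1 (fun x => ∏ n ∈ F, (1 - ψ n x)) :=
    contDiff_prod fun n _ => contDiff_const.sub (hψ n)
  have h2 : ∀ x, 0 ≤ ∏ n ∈ F, (1 - ψ n x) ∧ ∏ n ∈ F, (1 - ψ n x) ≤ 1 := fun x =>
    ⟨Finset.prod_nonneg fun n _ => (hb n x).1,
      Finset.prod_le_one (fun n _ => (hb n x).1) fun n _ => (hb n x).2⟩
  refine ⟨_, h1, h2, fun x hx => ?_, fun x hx => ?_, ?_⟩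
  · obtain ⟨n, hn, hxn⟩ := mem_iUnion₂.1 (hFc hx)
    rw [notMem_tsupport_iff_eventuallyEq]
    filter_upwards [Metric.isOpen_ball.mem_nhds hxn] with y hy
    exact Finset.prod_eq_zero hn (by rw [hψ1 n hn y hy, sub_self])
  · refine Finset.prod_eq_one fun n hn => ?_
    rw [hψ0 n hn x, sub_zero]
    by_contra! hlt
    refine hx (Metric.mem_thickening_iff.2 ⟨c n, (hFr n hn).1, ?_⟩)
    have := (hFr n hn).2.2.trans (min_le_left (ε / 3) (ε / (C + 1)))
    linarith
  · calc ∫⁻ x, ‖fderiv ℝ (fun x => ∏ n ∈ F, (1 - ψ n x)) x‖ₑ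
        ≤ ∫⁻ x, ∑ n ∈ F, ‖fderiv ℝ (ψ n) x‖ₑ := by
          refine lintegral_mono fun x => ?_
          simp only [← ofReal_norm]
          rw [← ENNReal.ofReal_sum_of_nonneg fun n _ => norm_nonneg _]
          exact ENNReal.ofReal_le_ofReal (h3 x)
      _ = ∑ n ∈ F, ∫⁻ x, ‖fderiv ℝ (ψ n) x‖ₑ :=
          lintegral_finsetSum _ fun n _ =>
            ((hψ n).continuous_fderiv one_ne_zero).enorm.measurable
      _ ≤ ∑ n ∈ F, ENNReal.ofReal (C * r n ^ m) := Finset.sum_le_sum hψd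
      _ = ENNReal.ofReal (∑ n ∈ F, C * r n ^ m) :=
          (ENNReal.ofReal_sum_of_nonneg fun n hn => by have := (hFr n hn).2.1; positivity).symm
      _ ≤ ENNReal.ofReal ε := by
          refine ENNReal.ofReal_le_ofReal ?_
          rw [← Finset.mul_sum]
          calc C * ∑ n ∈ F, r n ^ m ≤ C * (ε / (C + 1)) := by
                gcongr; exact hFs.trans (min_le_right _ _)
            _ ≤ ε := by
                rw [mul_div_assoc', div_le_iff₀ (by positivity)]; nlinarith

end Cutoff

/-! ### The Gauss-Green formula in general. -/

section GaussGreen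

variable {m : ℕ} {Ω : Set (Space (m + 1))} {f : Space (m + 1) → ℝ}

/-- The Gauss-Green formula on bounded domains with piecewise `C¹` boundary. -/
theorem gaussDefect_eq_zero (hΩ : IsOpen Ω) (hb : Bornology.IsBounded Ω)
    (hP : HasPiecewiseC1Boundary Ω) (hf : HasBoundedDerivOn Ω f)
    {v : Space (m + 1)} (hv : ‖v‖ ≤ 1) : gaussDefect Ω f v = 0 := by
  have hcl := hb.isCompact_closure
  have hfin : volume Ω < ⊤ := hb.measure_lt_top
  set Z := {x ∈ frontier Ω | ¬ IsRegularBoundaryPoint Ω x}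
  have hZcl : IsClosed Z := isClosed_singular hΩ
  have hZc : IsCompact Z := hcl.of_isClosed_subset hZcl ((sep_subset _ _).trans
    frontier_subset_closure)
  have hZ0 : μHE[m] Z = 0 := hP.null_singular
  choose η hηd hη01 hηZ hη1 hηi using fun j : ℕ =>
    exists_cutoff hZc hZ0 (Nat.one_div_pos_of_nat (α := ℝ) (n := j))
  have hlim : ∀ x, x ∉ Z → Filter.Tendsto (fun j => η j x) Filter.atTop (nhds 1) := by
    intro x hx
    obtain ⟨δ, hδ, hδZ⟩ := Metric.isOpen_iff.1 hZcl.isOpen_compl x hx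
    refine tendsto_const_nhds.congr' ?_
    filter_upwards [(tendsto_one_div_add_atTop_nhds_zero_nat (𝕜 := ℝ)).eventually
      (gt_mem_nhds hδ)] with j hj
    refine (hη1 j x fun hx' => ?_).symm
    obtain ⟨z, hz, hxz⟩ := Metric.mem_thickening_iff.1 hx'
    exact hδZ (Metric.mem_ball'.2 (hxz.trans hj)) hz
  have hηf : ∀ j, HasBoundedDerivOn Ω (fun x => η j x * f x) := fun j =>
    (HasBoundedDerivOn.of_contDiff hcl (hηd j)).mul hΩ hcl hf
  have hzero : ∀ j, gaussDefect Ω (fun x => η j x * f x) v = 0 := by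
    intro j
    refine gaussDefect_eq_zero_of_tsupport_disjoint hΩ hb hP (hηf j) (fun x hx hxs => ?_) hv
    by_contra hreg
    exact hηZ j x ⟨hx, hreg⟩ (tsupport_mul_subset_left hxs)
  have hηabs : ∀ j x, |η j x| ≤ 1 := fun j x => abs_le.2 ⟨by linarith [(hη01 j x).1], (hη01 j x).2⟩
  have i1 := hf.integrableOn_fderiv hΩ hfin v
  have i2 := integrableOn_mul_inner_outerNormal hΩ hb hP hf v
  have i3 : ∀ j, IntegrableOn (fun x => η j x * fderiv ℝ f x v) Ω := fun j =>
    i1.bdd_mul (c := 1) (hηd j).continuous.aestronglyMeasurable (.of_forall fun x => hηabs j x)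
  have hprod : ∀ j, ∀ x ∈ Ω, fderiv ℝ (fun x => η j x * f x) x v
      = η j x * fderiv ℝ f x v + f x * fderiv ℝ (η j) x v := by
    intro j x hx
    rw [fderiv_fun_mul ((hηd j).differentiable one_ne_zero x)
      (hf.differentiableOn.differentiableAt (hΩ.mem_nhds hx))]
    rfl
  have i4 : ∀ j, IntegrableOn (fun x => f x * fderiv ℝ (η j) x v) Ω := fun j => by
    refine (((hηf j).integrableOn_fderiv hΩ hfin v).sub (i3 j)).congr ?_
    refine (ae_restrict_iff' hΩ.measurableSet).2 (.of_forall fun x hx => ?_)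
    simp only [Pi.sub_apply]
    rw [hprod j x hx]; ring
  have t1 : Filter.Tendsto (fun j => ∫ x in Ω, η j x * fderiv ℝ f x v) Filter.atTop
      (nhds (∫ x in Ω, fderiv ℝ f x v)) := by
    refine tendsto_integral_of_dominated_convergence (fun x => |fderiv ℝ f x v|)
      (fun j => (i3 j).aestronglyMeasurable) i1.abs (fun j => .of_forall fun x => ?_) ?_
    · rw [Real.norm_eq_abs, abs_mul]
      exact mul_le_of_le_one_left (abs_nonneg _) (hηabs j x)
    · refine (ae_restrict_iff' hΩ.measurableSet).2 (.of_forall fun x hx => ?_)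
      have hxZ : x ∉ Z := fun h => by
        have := h.1
        rw [hΩ.frontier_eq] at this
        exact this.2 hx
      simpa using (hlim x hxZ).mul_const (fderiv ℝ f x v)
  -- The only term without a pointwise limit argument: `f` is bounded on `Ω` and the gradient of `η
  -- j` has `L¹` norm at most `1 / (j + 1)`.
  have t2 : Filter.Tendsto (fun j => ∫ x in Ω, f x * fderiv ℝ (η j) x v) Filter.atTop
      (nhds 0) := by
    obtain ⟨M, hM⟩ := hcl.exists_bound_of_continuousOn hf.continuousOn
    have hM' : ∀ x ∈ Ω, |f x| ≤ |M| := fun x hx => (hM x (subset_closure hx)).trans (le_abs_self M)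
    have hb2 : ∀ j : ℕ, ‖∫ x in Ω, f x * fderiv ℝ (η j) x v‖ ≤ |M| * (1 / ((j : ℝ) + 1)) := by
      intro j
      refine (norm_integral_le_lintegral_norm _).trans ?_
      refine ENNReal.toReal_le_of_le_ofReal (by positivity) ?_
      rw [ENNReal.ofReal_mul (abs_nonneg _)]
      calc ∫⁻ x in Ω, ENNReal.ofReal ‖f x * fderiv ℝ (η j) x v‖
          ≤ ∫⁻ x in Ω, ENNReal.ofReal |M| * ‖fderiv ℝ (η j) x‖ₑ := by
            refine setLIntegral_mono' hΩ.measurableSet fun x hx => ?_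
            rw [← ofReal_norm, ← ENNReal.ofReal_mul (abs_nonneg _), norm_mul]
            refine ENNReal.ofReal_le_ofReal (mul_le_mul (hM' x hx) ?_ (norm_nonneg _)
              (abs_nonneg _))
            exact ((fderiv ℝ (η j) x).le_opNorm v).trans
              (mul_le_of_le_one_right (norm_nonneg _) hv)
        _ ≤ ∫⁻ x, ENNReal.ofReal |M| * ‖fderiv ℝ (η j) x‖ₑ := setLIntegral_le_lintegral _ _
        _ = ENNReal.ofReal |M| * ∫⁻ x, ‖fderiv ℝ (η j) x‖ₑ :=
            lintegral_const_mul _ ((hηd j).continuous_fderiv one_ne_zero).enorm.measurable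
        _ ≤ ENNReal.ofReal |M| * ENNReal.ofReal (1 / ((j : ℝ) + 1)) := by
            gcongr; exact hηi j
    refine squeeze_zero_norm hb2 ?_
    simpa using (tendsto_one_div_add_atTop_nhds_zero_nat (𝕜 := ℝ)).const_mul |M|
  have t3 : Filter.Tendsto
      (fun j => ∫ x in frontier Ω, (η j x * f x) * inner ℝ (outerNormal Ω x) v ∂μHE[m])
      Filter.atTop (nhds (∫ x in frontier Ω, f x * inner ℝ (outerNormal Ω x) v ∂μHE[m])) := by
    refine tendsto_integral_of_dominated_convergence
      (fun x => |f x * inner ℝ (outerNormal Ω x) v|)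
      (fun j => (integrableOn_mul_inner_outerNormal hΩ hb hP (hηf j) v).aestronglyMeasurable)
      i2.abs (fun j => .of_forall fun x => ?_) ?_
    · rw [Real.norm_eq_abs, mul_assoc, abs_mul]
      exact mul_le_of_le_one_left (abs_nonneg _) (hηabs j x)
    · have : ∀ᵐ x ∂(μHE[m]).restrict (frontier Ω), x ∉ Z :=
        ae_restrict_of_ae (measure_eq_zero_iff_ae_notMem.1 hZ0)
      filter_upwards [this] with x hx
      simpa [mul_assoc] using (hlim x hx).mul_const (f x * inner ℝ (outerNormal Ω x) v)
  have e : ∀ j, (∫ x in Ω, η j x * fderiv ℝ f x v) + ∫ x in Ω, f x * fderiv ℝ (η j) x v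
      = ∫ x in frontier Ω, (η j x * f x) * inner ℝ (outerNormal Ω x) v ∂μHE[m] := by
    intro j
    rw [← integral_add (i3 j) (i4 j), ← sub_eq_zero, ← hzero j, gaussDefect]
    congr 1
    exact setIntegral_congr_fun hΩ.measurableSet fun x hx => (hprod j x hx).symm
  have t4 := t1.add t2
  simp only [e, add_zero] at t4
  rw [gaussDefect, tendsto_nhds_unique t4 t3, sub_self]

theorem integral_fderiv_eq_integral_frontier (hΩ : IsOpen Ω) (hb : Bornology.IsBounded Ω)
    (hP : HasPiecewiseC1Boundary Ω) (hf : HasBoundedDerivOn Ω f) (k : Fin (m + 1)) :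
    ∫ x in Ω, fderiv ℝ f x (EuclideanSpace.single k 1)
      = ∫ x in frontier Ω, f x * outerNormal Ω x k ∂μHE[m] := by
  have := gaussDefect_eq_zero hΩ hb hP hf (v := EuclideanSpace.single k 1) (by simp)
  rw [gaussDefect, sub_eq_zero] at this
  rw [this]
  simp [EuclideanSpace.inner_single_right]

end GaussGreen

/-! ### Definite block matrices and symmetrization. -/

section LinearAlgebra

variable {ι κ : Type*} [Fintype ι] [Fintype κ]

theorem posDef_fromBlocks_diagonal {P : Matrix ι ι ℝ} {N : Matrix κ κ ℝ} (hP : P.PosDef)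
    (hN : N.PosDef) : (Matrix.fromBlocks P 0 0 N).PosDef := by
  refine .of_dotProduct_mulVec_pos ?_ fun x hx => ?_
  · exact Matrix.IsHermitian.fromBlocks hP.isHermitian (by simp) hN.isHermitian
  · rw [← Sum.elim_comp_inl_inr x, Matrix.fromBlocks_mulVec]
    simp only [star_trivial, Matrix.zero_mulVec, add_zero, zero_add, Sum.elim_comp_inl,
      Sum.elim_comp_inr, sumElim_dotProduct_sumElim]
    by_cases h1 : x ∘ Sum.inl = 0
    · have h2 : x ∘ Sum.inr ≠ 0 := fun h2 => hx (by
        rw [← Sum.elim_comp_inl_inr x, h1, h2]; ext (i | i) <;> rfl)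
      exact add_pos_of_nonneg_of_pos (by simpa using hP.posSemidef.dotProduct_mulVec_nonneg (x ∘ Sum.inl))
        (by simpa using hN.dotProduct_mulVec_pos h2)
    · exact add_pos_of_pos_of_nonneg (by simpa using hP.dotProduct_mulVec_pos h1)
        (by simpa using hN.posSemidef.dotProduct_mulVec_nonneg (x ∘ Sum.inr))

theorem posSemidef_fromBlocks_zero {N : Matrix κ κ ℝ}
    (hN : N.PosSemidef) : (Matrix.fromBlocks (0 : Matrix ι ι ℝ) 0 0 N).PosSemidef := by
  refine .of_dotProduct_mulVec_nonneg ?_ fun x => ?_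
  · exact Matrix.IsHermitian.fromBlocks (Matrix.isHermitian_zero) (by simp) hN.isHermitian
  · rw [← Sum.elim_comp_inl_inr x, Matrix.fromBlocks_mulVec]
    simp only [star_trivial, Matrix.zero_mulVec, add_zero, zero_add, Sum.elim_comp_inl,
      Sum.elim_comp_inr, sumElim_dotProduct_sumElim, dotProduct_zero]
    simpa using hN.dotProduct_mulVec_nonneg (x ∘ Sum.inr)

variable [DecidableEq ι]

/-- `C` is a positive lower bound for the spectrum of `H`. -/
theorem exists_posSemidef_sub_smul_one {H : Matrix ι ι ℝ} (h : H.PosDef) :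
    ∃ C : ℝ, 0 < C ∧ (H - C • (1 : Matrix ι ι ℝ)).PosSemidef := by
  rcases subsingleton_or_nontrivial (Matrix ι ι ℝ) with _ | _
  · exact ⟨1, one_pos, by
      rw [Subsingleton.elim (H - (1 : ℝ) • (1 : Matrix ι ι ℝ)) 0]; exact Matrix.PosSemidef.zero⟩
  have h0 := Matrix.isStrictlyPositive_iff_posDef.2 h
  obtain ⟨C, hC, hCH⟩ := (CFC.exists_pos_algebraMap_le_iff h0.isSelfAdjoint).2
    fun x hx => h0.spectrum_pos hx
  rw [Matrix.le_iff, Algebra.algebraMap_eq_smul_one] at hCH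
  exact ⟨C, hC, hCH⟩

/-- The form of `Z` is at most `b ‖x‖²` with `b` the sum of the absolute entries, and that of `N` is
at least `C ‖x‖²`, so `s = b / C` works. -/
theorem exists_posSemidef_smul_sub {N Z : Matrix ι ι ℝ} (hN : N.PosDef) (hZ : Z.IsHermitian) :
    ∃ s : ℝ, 0 ≤ s ∧ (s • N - Z).PosSemidef := by
  obtain ⟨C, hC, hNC⟩ := exists_posSemidef_sub_smul_one hN
  set b := ∑ i, ∑ j, |Z i j|
  have hb0 : 0 ≤ b := Finset.sum_nonneg fun i _ => Finset.sum_nonneg fun j _ => abs_nonneg _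
  have hb : ∀ x : ι → ℝ, x ⬝ᵥ Z *ᵥ x ≤ b * (x ⬝ᵥ x) := by
    intro x
    have hx : ∀ i, x i * x i ≤ x ⬝ᵥ x := fun i =>
      Finset.single_le_sum (f := fun i => x i * x i) (fun j _ => mul_self_nonneg (x j))
        (Finset.mem_univ i)
    simp only [b, Finset.sum_mul]
    rw [dotProduct]
    refine Finset.sum_le_sum fun i _ => ?_
    rw [Matrix.mulVec, dotProduct, Finset.mul_sum]
    refine Finset.sum_le_sum fun j _ => ?_
    have h1 : |x i * x j| ≤ x ⬝ᵥ x := by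
      rw [abs_le]
      constructor <;> nlinarith [hx i, hx j, sq_nonneg (x i + x j), sq_nonneg (x i - x j)]
    calc x i * (Z i j * x j) = Z i j * (x i * x j) := by ring
      _ ≤ |Z i j| * |x i * x j| := by rw [← abs_mul]; exact le_abs_self _
      _ ≤ |Z i j| * (x ⬝ᵥ x) := by gcongr
  refine ⟨b / C, by positivity, .of_dotProduct_mulVec_nonneg ?_ fun x => ?_⟩
  · exact (hN.isHermitian.smul (by simp [IsSelfAdjoint])).sub hZ
  · have h1 := hNC.dotProduct_mulVec_nonneg x
    simp only [star_trivial, Matrix.sub_mulVec, Matrix.smul_mulVec, dotProduct_sub,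
      dotProduct_smul, smul_eq_mul, Matrix.one_mulVec] at h1 ⊢
    have h2 : b / C * (C * (x ⬝ᵥ x)) = b * (x ⬝ᵥ x) := by field_simp
    have h3 : b / C * (C * (x ⬝ᵥ x)) ≤ b / C * (x ⬝ᵥ N *ᵥ x) := by
      gcongr; linarith
    linarith [hb x]

variable [DecidableEq κ]

/-- A symmetric block matrix with negative definite first block becomes negative definite after
subtracting a large multiple of a positive definite matrix in the second block. -/
theorem exists_posDef_smul_sub_fromBlocks {P : Matrix ι ι ℝ} {Q : Matrix ι κ ℝ} {N W : Matrix κ κ ℝ}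
    (hP : (-P).PosDef) (hN : N.PosDef) (hW : W.IsHermitian) :
    ∃ K₀ : ℝ, 0 < K₀ ∧ ∀ K ≥ K₀,
      (K • Matrix.fromBlocks 0 0 0 N - Matrix.fromBlocks P Q Qᵀ W).PosDef := by
  -- Half of `-P` is spent on the Schur complement, which yields only semidefiniteness. The other
  -- half, together with `N / 2`, provides strict positivity; hence the `1 / 2` in `K₀`.
  set P' := (1 / 2 : ℝ) • (-P)
  have hP' : P'.PosDef := hP.smul (by norm_num)
  let : Invertible P' := hP'.isUnit.invertible
  set Z := W + Qᵀ * P'⁻¹ * Q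
  have hZ : Z.IsHermitian := by
    refine hW.add ?_
    have := Matrix.isHermitian_conjTranspose_mul_mul Q hP'.inv.isHermitian
    simpa using this
  obtain ⟨s, hs, hsN⟩ := exists_posSemidef_smul_sub hN hZ
  refine ⟨s + 1 / 2, by positivity, fun K hK => ?_⟩
  have h1 : (Matrix.fromBlocks P' (-Q) (-Q)ᴴ (s • N - W)).PosSemidef := by
    have e : s • N - W - (-Q)ᴴ * P'⁻¹ * (-Q) = s • N - Z := by
      rw [Matrix.conjTranspose_eq_transpose_of_trivial, Matrix.transpose_neg,
        Matrix.neg_mul, Matrix.mul_neg, Matrix.neg_mul, neg_neg]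
      simp only [Z]
      abel
    rw [Matrix.PosDef.fromBlocks₁₁ _ _ hP', e]
    exact hsN
  have h2 : (Matrix.fromBlocks P' 0 0 ((1 / 2 : ℝ) • N)).PosDef :=
    posDef_fromBlocks_diagonal hP' (hN.smul (by norm_num))
  have h3 : ((K - (s + 1 / 2)) • Matrix.fromBlocks (0 : Matrix ι ι ℝ) 0 0 N).PosSemidef :=
    (posSemidef_fromBlocks_zero hN.posSemidef).smul (sub_nonneg.2 hK)
  convert (h2.add_posSemidef h1).add_posSemidef h3 using 1
  simp only [Matrix.fromBlocks_smul, Matrix.fromBlocks_add, smul_zero, P',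
    sub_eq_add_neg, Matrix.fromBlocks_neg, Matrix.conjTranspose_eq_transpose_of_trivial,
    Matrix.transpose_neg, add_zero, zero_add]
  congr 1
  · module
  · module

theorem sqrt_mul_sqrt {A₀ : Matrix ι ι ℝ} (h : A₀.PosDef) : CFC.sqrt A₀ * CFC.sqrt A₀ = A₀ :=
  CFC.sqrt_mul_sqrt_self A₀ h.posSemidef.nonneg

theorem isUnit_sqrt {A₀ : Matrix ι ι ℝ} (h : A₀.PosDef) : IsUnit (CFC.sqrt A₀) := by
  have : IsUnit (CFC.sqrt A₀ * CFC.sqrt A₀) := by rw [sqrt_mul_sqrt h]; exact h.isUnit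
  exact isUnit_of_mul_isUnit_left this

theorem sqrt_transpose (A₀ : Matrix ι ι ℝ) : (CFC.sqrt A₀)ᵀ = CFC.sqrt A₀ := by
  have := (Matrix.nonneg_iff_posSemidef.1 (CFC.sqrt_nonneg A₀)).isHermitian
  rwa [Matrix.IsHermitian, Matrix.conjTranspose_eq_transpose_of_trivial] at this

theorem sqrt_inv_transpose (A₀ : Matrix ι ι ℝ) : ((CFC.sqrt A₀)⁻¹)ᵀ = (CFC.sqrt A₀)⁻¹ := by
  rw [Matrix.transpose_nonsing_inv, sqrt_transpose]

theorem symmetrized_transpose (A₀ M : Matrix ι ι ℝ) :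
    (symmetrized A₀ M)ᵀ = (CFC.sqrt A₀)⁻¹ * (A₀ * M)ᵀ * (CFC.sqrt A₀)⁻¹ := by
  rw [symmetrized, Matrix.transpose_mul, Matrix.transpose_mul, sqrt_inv_transpose, Matrix.mul_assoc]

theorem isSymm_symmetrized {A₀ M : Matrix ι ι ℝ} (hM : (A₀ * M).IsSymm) :
    (symmetrized A₀ M).IsSymm := by
  rw [Matrix.IsSymm, symmetrized_transpose, hM.eq, symmetrized]

/-- Immediate from `A₀ = S * S`. This intertwining relation is what makes `w = S U` solve the
symmetrized system. -/
theorem symmetrized_mul_sqrt {A₀ : Matrix ι ι ℝ} (h : A₀.PosDef) (M : Matrix ι ι ℝ) :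
    symmetrized A₀ M * CFC.sqrt A₀ = CFC.sqrt A₀ * M := by
  have hS := (Matrix.isUnit_iff_isUnit_det _).1 (isUnit_sqrt h)
  rw [symmetrized, Matrix.nonsing_inv_mul_cancel_right _ _ hS]
  have e : A₀ * M = CFC.sqrt A₀ * (CFC.sqrt A₀ * M) := by
    rw [← Matrix.mul_assoc, sqrt_mul_sqrt h]
  rw [e, Matrix.nonsing_inv_mul_cancel_left _ _ hS]

/-- If `X a` is symmetric with `X` positive definite and `a` has only negative eigenvalues, then
`X a` is negative definite. -/
theorem posDef_neg_mul {X a : Matrix ι ι ℝ} (hX : X.PosDef) (hXa : (X * a).IsSymm)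
    (ha : ∀ ev : ℝ, Module.End.HasEigenvalue (Matrix.toLin' a) ev → ev < 0) :
    (-(X * a)).PosDef := by
  set S := CFC.sqrt X
  have hS : IsUnit S.det := (Matrix.isUnit_iff_isUnit_det _).1 (isUnit_sqrt hX)
  -- `G = S a S⁻¹` is symmetric and similar to `a`, so its eigenvalues are real and are eigenvalues
  -- of `a`; `X a = S G S` then inherits definiteness by congruence.
  set G := symmetrized X a
  have hG : (-G).IsHermitian := by
    rw [Matrix.IsHermitian, Matrix.conjTranspose_eq_transpose_of_trivial, Matrix.transpose_neg,
      (isSymm_symmetrized hXa).eq]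
  have hGS : G * S = S * a := symmetrized_mul_sqrt hX a
  have haS : a * S⁻¹ = S⁻¹ * G := by
    calc a * S⁻¹ = S⁻¹ * (S * a) * S⁻¹ := by rw [Matrix.nonsing_inv_mul_cancel_left _ _ hS]
      _ = S⁻¹ * (G * S) * S⁻¹ := by rw [hGS]
      _ = S⁻¹ * G := by
        rw [← Matrix.mul_assoc, Matrix.mul_nonsing_inv_cancel_right _ _ hS]
  have hGpos : (-G).PosDef := by
    rw [hG.posDef_iff_eigenvalues_pos]
    intro i
    have h1 := hG.mulVec_eigenvectorBasis i
    set v := (hG.eigenvectorBasis i).ofLp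
    have hv : v ≠ 0 := by
      intro hv
      have := hG.eigenvectorBasis.orthonormal.ne_zero i
      exact this (by ext j; exact congrFun hv j)
    have h2 : G *ᵥ v = (-hG.eigenvalues i) • v := by
      rw [Matrix.neg_mulVec] at h1
      rw [neg_smul, ← h1, neg_neg]
    have h3 : a *ᵥ (S⁻¹ *ᵥ v) = (-hG.eigenvalues i) • (S⁻¹ *ᵥ v) := by
      rw [Matrix.mulVec_mulVec, haS, ← Matrix.mulVec_mulVec, h2, Matrix.mulVec_smul]
    have h4 : S⁻¹ *ᵥ v ≠ 0 := by
      intro h0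
      have := congrArg (S *ᵥ ·) h0
      simp only [Matrix.mulVec_mulVec, Matrix.mul_nonsing_inv _ hS, Matrix.one_mulVec,
        Matrix.mulVec_zero] at this
      exact hv this
    have := ha (-hG.eigenvalues i) (Module.End.hasEigenvalue_of_hasEigenvector
      (x := S⁻¹ *ᵥ v) ⟨Module.End.mem_eigenspace_iff.2 (by rw [Matrix.toLin'_apply]; exact h3), h4⟩)
    linarith
  have e : -(X * a) = Sᴴ * (-G) * S := by
    rw [Matrix.conjTranspose_eq_transpose_of_trivial, sqrt_transpose, Matrix.mul_neg,
      Matrix.neg_mul, Matrix.mul_assoc, hGS, ← Matrix.mul_assoc, sqrt_mul_sqrt hX]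
  rw [e]
  exact (Matrix.IsUnit.posDef_star_left_conjugate_iff (isUnit_sqrt hX)).2 hGpos

end LinearAlgebra

/-! ### Feasibility of linear potentials. -/

section Feasibility

theorem gradient_linearPotential {d : ℕ} (α : Fin d → ℝ) (K : ℝ) (x : Space d) :
    gradient (linearPotential α K) x = WithLp.toLp 2 fun k => α k / K := by
  have e : linearPotential α K =
      (InnerProductSpace.toDual ℝ (Space d) (WithLp.toLp 2 fun k => α k / K) : Space d → ℝ) := by
    ext y
    rw [InnerProductSpace.toDual_apply_apply, EuclideanSpace.inner_eq_star_dotProduct, dotProduct]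
    simp [linearPotential, mul_comm]
  have h : HasGradientAt (linearPotential α K) (WithLp.toLp 2 fun k => α k / K) x := by
    rw [hasGradientAt_iff_hasFDerivAt, e]
    exact ContinuousLinearMap.hasFDerivAt _
  exact h.gradient

theorem contDiff_linearPotential {d : ℕ} (α : Fin d → ℝ) (K : ℝ) :
    ContDiff ℝ 1 (linearPotential α K) := by
  unfold linearPotential
  fun_prop

theorem remainder_const {d : ℕ} {ι : Type*} [Fintype ι] (A : Fin d → Matrix ι ι ℝ)
    (B : Matrix ι ι ℝ) (x : Space d) :
    remainder (fun k _ => A k) (fun _ => B) x = -(B + Bᵀ) := by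
  rw [remainder, symPart, smul_smul]
  norm_num
  ext i j
  simp

/-- Linear potentials with small slope are feasible for systems with partial relaxation. -/
theorem SatisfiesSSC.exists_isFeasiblePotential {d p r : ℕ}
    {a : Fin d → Matrix (Fin p) (Fin p) ℝ} {b : Fin d → Matrix (Fin p) (Fin r) ℝ}
    {c : Fin d → Matrix (Fin r) (Fin p) ℝ} {e : Fin d → Matrix (Fin r) (Fin r) ℝ}
    {f : Matrix (Fin r) (Fin r) ℝ}
    {X₁ : Matrix (Fin p) (Fin p) ℝ} {X₂ : Matrix (Fin r) (Fin r) ℝ} {α : Fin d → ℝ}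
    (h : SatisfiesSSC a b c e f X₁ X₂ α) :
    ∃ K₀ : ℝ, 0 < K₀ ∧ ∀ K ≥ K₀, ∃ C : ℝ, 0 < C ∧
      IsFeasiblePotential
        (fun k _ => symmetrized (Matrix.fromBlocks X₁ 0 0 X₂)
          (Matrix.fromBlocks (a k) (b k) (c k) (e k)))
        (fun _ => symmetrized (Matrix.fromBlocks X₁ 0 0 X₂) (Matrix.fromBlocks 0 0 0 f)) C
        (linearPotential α K) := by
  set A₀ := Matrix.fromBlocks X₁ 0 0 X₂ with hA₀
  set S := CFC.sqrt A₀ with hS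
  have hX₁ : X₁.PosDef := by
    exact h.posDef.submatrix (e := Sum.inl) Sum.inl_injective
  set M := A₀ * ∑ k, α k • Matrix.fromBlocks (a k) (b k) (c k) (e k) with hM
  have hMsymm : Mᵀ = M := by
    rw [hM, Finset.mul_sum, Matrix.transpose_sum]
    refine Finset.sum_congr rfl fun k _ => ?_
    rw [Matrix.mul_smul, Matrix.transpose_smul, (h.symmetric k).eq]
  have hsum : ∑ k, α k • Matrix.fromBlocks (a k) (b k) (c k) (e k)
      = Matrix.fromBlocks (∑ k, α k • a k) (∑ k, α k • b k) (∑ k, α k • c k)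
        (∑ k, α k • e k) := by
    ext (i | i) (j | j) <;> simp [Matrix.sum_apply]
  have hMblocks : M = Matrix.fromBlocks (X₁ * ∑ k, α k • a k) (X₁ * ∑ k, α k • b k)
      (X₂ * ∑ k, α k • c k) (X₂ * ∑ k, α k • e k) := by
    rw [hM, hsum, hA₀, Matrix.fromBlocks_multiply]
    simp
  have hMs := hMsymm
  rw [hMblocks, Matrix.fromBlocks_transpose, Matrix.fromBlocks_inj] at hMs
  obtain ⟨hs1, -, hs3, hs4⟩ := hMs
  have hneg := posDef_neg_mul hX₁ hs1 h.negative
  obtain ⟨K₀, hK₀, hK⟩ := exists_posDef_smul_sub_fromBlocks (Q := X₁ * ∑ k, α k • b k) hneg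
    h.dissipative (W := X₂ * ∑ k, α k • e k) hs4
  refine ⟨K₀, hK₀, fun K hKK => ?_⟩
  have hK0 : 0 < K := hK₀.trans_le hKK
  -- Dividing by `K` moves the large factor from the dissipative block to the slopes `α k / K`. The
  -- constant `C` found below therefore depends on `K`.
  have h1 := (hK K hKK).smul (inv_pos.2 hK0)
  rw [hs3, ← hMblocks, smul_sub, smul_smul, inv_mul_cancel₀ hK0.ne', one_smul] at h1
  have hSu : IsUnit S⁻¹ := (Matrix.isUnit_nonsing_inv_iff).2 (isUnit_sqrt h.posDef)
  have h2 := (Matrix.IsUnit.posDef_star_left_conjugate_iff hSu).2 h1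
  rw [Matrix.star_eq_conjTranspose, Matrix.conjTranspose_eq_transpose_of_trivial,
    sqrt_inv_transpose] at h2
  obtain ⟨C, hC, hH⟩ := exists_posSemidef_sub_smul_one h2
  refine ⟨C, hC, contDiff_linearPotential α K, fun x => ?_⟩
  convert hH using 1
  have e1 : ∑ k, gradient (linearPotential α K) x k •
      symmetrized A₀ (Matrix.fromBlocks (a k) (b k) (c k) (e k)) = K⁻¹ • (S⁻¹ * M * S⁻¹) := by
    rw [gradient_linearPotential, hM, Finset.mul_sum, Finset.mul_sum, Finset.sum_mul,
      Finset.smul_sum]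
    refine Finset.sum_congr rfl fun k _ => ?_
    rw [Matrix.mul_smul, Matrix.mul_smul, Matrix.smul_mul, smul_smul, symmetrized,
      ← div_eq_inv_mul]
  have e2 : A₀ * Matrix.fromBlocks 0 0 0 f + (A₀ * Matrix.fromBlocks 0 0 0 f)ᵀ
      = Matrix.fromBlocks 0 0 0 (X₂ * f + fᵀ * X₂) := by
    have hX₂ : X₂ᵀ = X₂ := by
      have : X₂.PosDef := by
        exact h.posDef.submatrix (e := Sum.inr) Sum.inr_injective
      simpa [Matrix.IsHermitian] using this.isHermitian
    rw [hA₀, Matrix.fromBlocks_multiply, Matrix.fromBlocks_transpose, Matrix.fromBlocks_add]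
    simp [hX₂]
  have e3 : symmetrized A₀ (Matrix.fromBlocks 0 0 0 f)
      + (symmetrized A₀ (Matrix.fromBlocks 0 0 0 f))ᵀ
      = S⁻¹ * Matrix.fromBlocks 0 0 0 (X₂ * f + fᵀ * X₂) * S⁻¹ := by
    rw [symmetrized_transpose, symmetrized, ← Matrix.add_mul, ← Matrix.mul_add, e2]
  rw [remainder_const, e1, e3, Matrix.mul_sub, Matrix.sub_mul, Matrix.mul_smul, Matrix.smul_mul]
  abel

end Feasibility

/-! ### Change of unknown and bounds for classical solutions. -/

section Transformation

variable {d : ℕ} {ι : Type*} [Fintype ι] {T : ℝ} {Ω : Set (Space d)}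

theorem IsClassicalSolution.differentiableAt {A : Fin d → Space d → Matrix ι ι ℝ}
    {B : Space d → Matrix ι ι ℝ} {w : ℝ → Space d → ι → ℝ} (hΩ : IsOpen Ω)
    (h : IsClassicalSolution A B T Ω w) {t : ℝ} (ht : t ∈ Ioo 0 T) {x : Space d} (hx : x ∈ Ω) :
    DifferentiableAt ℝ (fun z : ℝ × Space d => w z.1 z.2) (t, x) := by
  have : Ico 0 T ×ˢ closure Ω ∈ nhds (t, x) :=
    prod_mem_nhds (Ico_mem_nhds ht.1 ht.2) (Filter.mem_of_superset (hΩ.mem_nhds hx) subset_closure)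
  exact (h.contDiffOn.contDiffAt this).differentiableAt one_ne_zero

theorem hasDerivAt_slice {w : ℝ → Space d → ι → ℝ} {t : ℝ} {x : Space d}
    (h : DifferentiableAt ℝ (fun z : ℝ × Space d => w z.1 z.2) (t, x)) :
    HasDerivAt (fun s => w s x) (fderiv ℝ (fun z : ℝ × Space d => w z.1 z.2) (t, x) (1, 0)) t :=
  HasFDerivAt.comp_hasDerivAt (f := fun s : ℝ => (s, x)) t h.hasFDerivAt
    ((hasDerivAt_id t).prodMk (hasDerivAt_const t x))

theorem hasFDerivAt_slice {w : ℝ → Space d → ι → ℝ} {t : ℝ} {x : Space d}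
    (h : DifferentiableAt ℝ (fun z : ℝ × Space d => w z.1 z.2) (t, x)) :
    HasFDerivAt (w t) ((fderiv ℝ (fun z : ℝ × Space d => w z.1 z.2) (t, x)).comp
      (ContinuousLinearMap.inr ℝ ℝ (Space d))) x :=
  h.hasFDerivAt.comp x (hasFDerivAt_prodMk_right t x)

/-- A linear change of variables which intertwines the coefficients maps solutions to solutions. -/
theorem IsClassicalSolution.mulVec {A A' : Fin d → Matrix ι ι ℝ} {B B' S : Matrix ι ι ℝ}
    {U : ℝ → Space d → ι → ℝ} (hΩ : IsOpen Ω)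
    (h : IsClassicalSolution (fun k _ => A k) (fun _ => B) T Ω U)
    (hA : ∀ k, A' k * S = S * A k) (hB : B' * S = S * B) :
    IsClassicalSolution (fun k _ => A' k) (fun _ => B') T Ω (fun t x => S *ᵥ U t x) := by
  set L : (ι → ℝ) →L[ℝ] (ι → ℝ) := LinearMap.toContinuousLinearMap (Matrix.mulVecLin S)
  have hL : ∀ v, S *ᵥ v = L v := fun v => rfl
  refine ⟨?_, fun t ht x hx => ?_⟩
  · exact L.contDiff.comp_contDiffOn h.contDiffOn
  · have hd := h.differentiableAt hΩ ht hx
    have h1 : deriv (fun s => S *ᵥ U s x) t = S *ᵥ deriv (fun s => U s x) t := by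
      have := hasDerivAt_slice hd
      rw [this.deriv]
      exact (L.hasFDerivAt.comp_hasDerivAt t this).deriv
    have h2 : ∀ v, fderiv ℝ (fun y => S *ᵥ U t y) x v = S *ᵥ fderiv ℝ (U t) x v := by
      intro v
      have := hasFDerivAt_slice hd
      rw [this.fderiv]
      have h3 := (L.hasFDerivAt.comp x this).fderiv
      exact congrArg (fun l => l v) h3
    have h3 := congrArg (S *ᵥ ·) (h.equation t ht x hx)
    simp only [Matrix.mulVec_add, Matrix.mulVec_zero, Matrix.mulVec_sum, Matrix.mulVec_mulVec,
      ← hB, ← hA] at h3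
    rw [h1]
    simp only [h2, Matrix.mulVec_mulVec]
    exact h3

end Transformation

/-- `s` need not have unique derivatives at its boundary points, so no continuous extension of
`fderiv` is used. Near each point of `K` some continuous derivative field exists, is bounded, and
agrees with `fderiv` at interior points; compactness gives a uniform bound. -/
theorem exists_bound_fderiv_of_contDiffOn {E F : Type*} [NormedAddCommGroup E] [NormedSpace ℝ E]
    [NormedAddCommGroup F] [NormedSpace ℝ F] {g : E → F} {s K : Set E}
    (hg : ContDiffOn ℝ 1 g s) (hK : IsCompact K) (hKs : K ⊆ s) :
    ∃ M, ∀ z ∈ K ∩ interior s, ‖fderiv ℝ g z‖ ≤ M := by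
  refine hK.induction_on (p := fun t => ∃ M, ∀ z ∈ t ∩ interior s, ‖fderiv ℝ g z‖ ≤ M)
    ⟨0, by simp⟩ (fun t t' htt' ⟨M, hM⟩ => ⟨M, fun z hz => hM z ⟨htt' hz.1, hz.2⟩⟩) ?_ ?_
  · rintro t t' ⟨M, hM⟩ ⟨M', hM'⟩
    refine ⟨max M M', fun z hz => ?_⟩
    rcases hz.1 with h | h
    · exact (hM z ⟨h, hz.2⟩).trans (le_max_left _ _)
    · exact (hM' z ⟨h, hz.2⟩).trans (le_max_right _ _)
  · intro z hz
    have h1 : ContDiffWithinAt ℝ (0 + 1) g s z := by simpa using hg z (hKs hz)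
    obtain ⟨u, hu, -, g', hg', hc⟩ := (contDiffWithinAt_succ_iff_hasFDerivWithinAt (by simp)).1 h1
    rw [insert_eq_of_mem (hKs hz)] at hu
    have hb : ∀ᶠ y in nhdsWithin z u, ‖g' y‖ < ‖g' z‖ + 1 :=
      (hc.continuousWithinAt.norm).eventually (gt_mem_nhds (lt_add_one _))
    obtain ⟨O, hO, hzO, hOu⟩ := mem_nhdsWithin.1 hu
    have hb' : ∀ᶠ y in nhdsWithin z s, y ∈ O ∧ ‖g' y‖ < ‖g' z‖ + 1 :=
      Filter.Eventually.and (nhdsWithin_le_nhds (hO.mem_nhds hzO)) (nhdsWithin_le_of_mem hu hb)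
    refine ⟨_, nhdsWithin_mono z hKs hb', ‖g' z‖ + 1, fun y hy => ?_⟩
    have hyu : u ∈ nhds y := Filter.mem_of_superset
      (Filter.inter_mem (hO.mem_nhds hy.1.1) (mem_interior_iff_mem_nhds.1 hy.2)) hOu
    rw [((hg' y (mem_of_mem_nhds hyu)).hasFDerivAt hyu).fderiv]
    exact hy.1.2.le

/-! ### Quadratic forms and the time derivative of the Lyapunov function. -/

section QuadraticForm

variable {ι : Type*} [Fintype ι]

theorem hasDerivAt_dotProduct_mulVec {p : ℝ → ι → ℝ} {p' : ι → ℝ} {t : ℝ}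
    (hp : HasDerivAt p p' t) {M : Matrix ι ι ℝ} (hM : M.IsSymm) :
    HasDerivAt (fun s => p s ⬝ᵥ M *ᵥ p s) (2 * (p t ⬝ᵥ M *ᵥ p')) t := by
  have hi : ∀ i, HasDerivAt (fun s => p s i) (p' i) t := fun i => (hasDerivAt_pi.1 hp) i
  have hm : ∀ i, HasDerivAt (fun s => (M *ᵥ p s) i) ((M *ᵥ p') i) t := fun i =>
    HasDerivAt.fun_sum fun j _ => (hi j).const_mul (M i j)
  have h := HasDerivAt.fun_sum (u := Finset.univ) fun i _ => (hi i).mul (hm i)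
  refine h.congr_deriv ?_
  have e : p' ⬝ᵥ M *ᵥ p t = p t ⬝ᵥ M *ᵥ p' := by
    rw [Matrix.dotProduct_mulVec, ← Matrix.mulVec_transpose, hM.eq, dotProduct_comm]
  rw [Finset.sum_add_distrib]
  change p' ⬝ᵥ M *ᵥ p t + p t ⬝ᵥ M *ᵥ p' = _
  rw [e, two_mul]

theorem continuousOn_dotProduct_self {X : Type*} [TopologicalSpace X] {s : Set X} {p : X → ι → ℝ}
    (hp : ContinuousOn p s) : ContinuousOn (fun x => p x ⬝ᵥ p x) s :=
  (continuous_id.dotProduct continuous_id).comp_continuousOn hp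

theorem HasBoundedDerivOn.dotProduct_mulVec {E : Type*} [NormedAddCommGroup E] [NormedSpace ℝ E]
    {Ω : Set E} (hΩ : IsOpen Ω) (hc : IsCompact (closure Ω)) {p : E → ι → ℝ}
    (hp : ∀ i, HasBoundedDerivOn Ω fun x => p x i) (M : Matrix ι ι ℝ) :
    HasBoundedDerivOn Ω fun x => p x ⬝ᵥ M *ᵥ p x :=
  .sum hΩ _ fun i _ => (hp i).mul hΩ hc <| .sum hΩ _ fun j _ =>
    (HasBoundedDerivOn.of_contDiff hc contDiff_const).mul hΩ hc (hp j)

end QuadraticForm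

section Decay

variable {m : ℕ} {ι : Type*} [Fintype ι] {T : ℝ} {Ω : Set (Space (m + 1))}
  {A : Fin (m + 1) → Matrix ι ι ℝ} {B : Matrix ι ι ℝ} {w : ℝ → Space (m + 1) → ι → ℝ}

theorem IsClassicalSolution.exists_bound (hb : Bornology.IsBounded Ω)
    (h : IsClassicalSolution (fun k _ => A k) (fun _ => B) T Ω w) {a b : ℝ} (ha : 0 ≤ a)
    (hbT : b < T) : ∃ M, ∀ t ∈ Icc a b, ∀ x ∈ closure Ω, ‖w t x‖ ≤ M := by
  have hK : IsCompact (Icc a b ×ˢ closure Ω) := isCompact_Icc.prod hb.isCompact_closure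
  have hKs : Icc a b ×ˢ closure Ω ⊆ Ico 0 T ×ˢ closure Ω :=
    prod_mono (fun t ht => ⟨ha.trans ht.1, ht.2.trans_lt hbT⟩) Subset.rfl
  obtain ⟨M, hM⟩ := hK.exists_bound_of_continuousOn (h.contDiffOn.continuousOn.mono hKs)
  exact ⟨M, fun t ht x hx => hM (t, x) ⟨ht, hx⟩⟩

/-- The window starts at `a > 0` so that every `(t, x)` with `x ∈ Ω` is interior to the space-time
domain, where `fderiv` is the derivative of the solution. -/
theorem IsClassicalSolution.exists_bound_fderiv (hΩ : IsOpen Ω) (hb : Bornology.IsBounded Ω)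
    (h : IsClassicalSolution (fun k _ => A k) (fun _ => B) T Ω w) {a b : ℝ} (ha : 0 < a)
    (hbT : b < T) : ∃ M, ∀ t ∈ Icc a b, ∀ x ∈ Ω,
      ‖fderiv ℝ (fun z : ℝ × Space (m + 1) => w z.1 z.2) (t, x)‖ ≤ M := by
  have hK : IsCompact (Icc a b ×ˢ closure Ω) := isCompact_Icc.prod hb.isCompact_closure
  have hKs : Icc a b ×ˢ closure Ω ⊆ Ico 0 T ×ˢ closure Ω :=
    prod_mono (fun t ht => ⟨ha.le.trans ht.1, ht.2.trans_lt hbT⟩) Subset.rfl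
  obtain ⟨M, hM⟩ := exists_bound_fderiv_of_contDiffOn h.contDiffOn hK hKs
  refine ⟨M, fun t ht x hx => hM (t, x) ⟨⟨ht, subset_closure hx⟩, ?_⟩⟩
  rw [mem_interior_iff_mem_nhds]
  exact prod_mem_nhds (Ico_mem_nhds (ha.trans_le ht.1) (ht.2.trans_lt hbT))
    (Filter.mem_of_superset (hΩ.mem_nhds hx) subset_closure)

theorem IsClassicalSolution.continuousOn_slice
    (h : IsClassicalSolution (fun k _ => A k) (fun _ => B) T Ω w) {t : ℝ} (ht : t ∈ Ico 0 T) :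
    ContinuousOn (w t) (closure Ω) :=
  h.contDiffOn.continuousOn.comp (f := fun x => (t, x)) (by fun_prop) fun _ hx => ⟨ht, hx⟩

theorem IsClassicalSolution.hasBoundedDerivOn (hΩ : IsOpen Ω) (hb : Bornology.IsBounded Ω)
    (h : IsClassicalSolution (fun k _ => A k) (fun _ => B) T Ω w) {t : ℝ} (ht : t ∈ Ioo 0 T)
    (i : ι) : HasBoundedDerivOn Ω fun x => w t x i := by
  have hd : ∀ x ∈ Ω, HasFDerivAt (fun x => w t x i) ((ContinuousLinearMap.proj i).comp
      ((fderiv ℝ (fun z : ℝ × Space (m + 1) => w z.1 z.2) (t, x)).comp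
      (ContinuousLinearMap.inr ℝ ℝ (Space (m + 1))))) x := fun x hx =>
    hasFDerivAt_pi'.1 (hasFDerivAt_slice (h.differentiableAt hΩ ht hx)) i
  obtain ⟨M, hM⟩ := h.exists_bound_fderiv hΩ hb ht.1 ht.2
  refine ⟨?_, fun x hx => (hd x hx).differentiableAt.differentiableWithinAt, M, fun x hx => ?_⟩
  · exact (continuous_apply i).comp_continuousOn (h.continuousOn_slice ⟨ht.1.le, ht.2⟩)
  · rw [(hd x hx).fderiv]
    have hMx := hM t (left_mem_Icc.2 le_rfl) x hx
    refine ContinuousLinearMap.opNorm_le_bound _ ((norm_nonneg _).trans hMx) fun v => ?_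
    refine (norm_le_pi_norm _ i).trans ?_
    refine (ContinuousLinearMap.le_of_opNorm_le _ hMx _).trans (le_of_eq ?_)
    simp [Prod.norm_def]

theorem abs_dotProduct_le (u v : ι → ℝ) : |u ⬝ᵥ v| ≤ Fintype.card ι * (‖u‖ * ‖v‖) := by
  rw [dotProduct]
  refine (Finset.abs_sum_le_sum_abs _ _).trans ?_
  calc ∑ i, |u i * v i| ≤ ∑ _i : ι, ‖u‖ * ‖v‖ := by
        refine Finset.sum_le_sum fun i _ => ?_
        rw [abs_mul]
        exact mul_le_mul (norm_le_pi_norm u i) (norm_le_pi_norm v i) (abs_nonneg _) (norm_nonneg _)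
    _ = Fintype.card ι * (‖u‖ * ‖v‖) := by simp

variable {μ : Space (m + 1) → ℝ}

/-- Needed up to `t = 0`, where no time derivative is available, to compare with the initial value
`L(0)`. -/
theorem lyapunov_continuousOn (hΩ : IsOpen Ω) (hb : Bornology.IsBounded Ω)
    (hμ : Continuous μ) (h : IsClassicalSolution (fun k _ => A k) (fun _ => B) T Ω w)
    {b : ℝ} (hbT : b < T) : ContinuousOn (lyapunov Ω μ w) (Icc 0 b) := by
  obtain ⟨M, hM⟩ := h.exists_bound hb le_rfl hbT
  obtain ⟨E, hE⟩ := hb.isCompact_closure.exists_bound_of_continuousOn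
    (Real.continuous_exp.comp hμ).continuousOn
  have hIco : ∀ t ∈ Icc 0 b, t ∈ Ico 0 T := fun t ht => ⟨ht.1, ht.2.trans_lt hbT⟩
  refine continuousOn_of_dominated (bound := fun _ => Fintype.card ι * (M * M) * E)
    (fun t ht => ?_) (fun t ht => ?_) ?_ ?_
  · have := (h.continuousOn_slice (hIco t ht)).mono (subset_closure (s := Ω))
    refine ContinuousOn.aestronglyMeasurable ?_ hΩ.measurableSet
    exact (continuousOn_dotProduct_self this).mul (Real.continuous_exp.comp hμ).continuousOn
  · refine (ae_restrict_iff' hΩ.measurableSet).2 (.of_forall fun x hx => ?_)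
    have h1 := hM t ht x (subset_closure hx)
    have h0 := (norm_nonneg _).trans h1
    rw [norm_mul]
    refine mul_le_mul ((abs_dotProduct_le _ _).trans ?_) (hE x (subset_closure hx))
      (norm_nonneg _) (by positivity)
    gcongr
  · exact (integrableOn_const_iff (by finiteness)).2 (.inr hb.measure_lt_top)
  · refine (ae_restrict_iff' hΩ.measurableSet).2 (.of_forall fun x hx => ?_)
    have : ContinuousOn (fun t => w t x) (Icc 0 b) :=
      h.contDiffOn.continuousOn.comp (f := fun t => (t, x)) (by fun_prop)
        fun t ht => ⟨hIco t ht, subset_closure hx⟩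
    exact (continuousOn_dotProduct_self this).mul continuousOn_const

theorem hasDerivAt_lyapunov (hΩ : IsOpen Ω) (hb : Bornology.IsBounded Ω)
    (hμ : Continuous μ) (h : IsClassicalSolution (fun k _ => A k) (fun _ => B) T Ω w)
    {t : ℝ} (ht : t ∈ Ioo 0 T) :
    IntegrableOn (fun x => 2 * (w t x ⬝ᵥ deriv (fun s => w s x) t) * Real.exp (μ x)) Ω ∧
    HasDerivAt (lyapunov Ω μ w)
      (∫ x in Ω, 2 * (w t x ⬝ᵥ deriv (fun s => w s x) t) * Real.exp (μ x)) t := by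
  classical
  set g : ℝ × Space (m + 1) → ι → ℝ := fun z => w z.1 z.2
  -- On a compact time window inside `(0, T)` the solution and its derivative are uniformly bounded,
  -- which gives a constant dominating function.
  obtain ⟨a, ha0, hat⟩ := exists_between ht.1
  obtain ⟨b, htb, hbT⟩ := exists_between ht.2
  obtain ⟨M, hM⟩ := h.exists_bound hb ha0.le hbT
  obtain ⟨M', hM'⟩ := h.exists_bound_fderiv hΩ hb ha0 hbT
  obtain ⟨E, hE⟩ := hb.isCompact_closure.exists_bound_of_continuousOn
    (Real.continuous_exp.comp hμ).continuousOn
  have hT : ∀ s ∈ Icc a b, s ∈ Ioo 0 T := fun s hs => ⟨ha0.trans_le hs.1, hs.2.trans_lt hbT⟩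
  have hmeas : ∀ s ∈ Icc a b, AEStronglyMeasurable (fun x => (w s x ⬝ᵥ w s x) * Real.exp (μ x))
      (volume.restrict Ω) := fun s hs => by
    have := (h.continuousOn_slice (Ioo_subset_Ico_self (hT s hs))).mono (subset_closure (s := Ω))
    refine ContinuousOn.aestronglyMeasurable ?_ hΩ.measurableSet
    exact (continuousOn_dotProduct_self this).mul (Real.continuous_exp.comp hμ).continuousOn
  have htab : t ∈ Icc a b := ⟨hat.le, htb.le⟩
  have hconst : ∀ c : ℝ, Integrable (fun _ : Space (m + 1) => c) (volume.restrict Ω) := fun c =>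
    (integrableOn_const_iff (by finiteness)).2 (.inr hb.measure_lt_top)
  have key := hasDerivAt_integral_of_dominated_loc_of_deriv_le (μ := volume.restrict Ω)
    (F := fun s x => (w s x ⬝ᵥ w s x) * Real.exp (μ x))
    (F' := fun s x => 2 * (w s x ⬝ᵥ fderiv ℝ g (s, x) (1, 0)) * Real.exp (μ x))
    (x₀ := t) (s := Icc a b) (bound := fun _ => 2 * (Fintype.card ι * (M * M')) * E)
    (Icc_mem_nhds hat htb)
    (by filter_upwards [Icc_mem_nhds hat htb] with s hs using hmeas s hs) ?_ ?_ ?_ (hconst _) ?_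
  · have e : ∀ x ∈ Ω, 2 * (w t x ⬝ᵥ fderiv ℝ g (t, x) (1, 0)) * Real.exp (μ x)
        = 2 * (w t x ⬝ᵥ deriv (fun s => w s x) t) * Real.exp (μ x) := fun x hx => by
      rw [(hasDerivAt_slice (h.differentiableAt hΩ ht hx)).deriv]
    refine ⟨(integrableOn_congr_fun e hΩ.measurableSet).1 key.1, ?_⟩
    rw [← setIntegral_congr_fun hΩ.measurableSet e]
    exact key.2
  · refine Integrable.mono' (hconst (Fintype.card ι * (M * M) * E)) (hmeas t htab) ?_
    refine (ae_restrict_iff' hΩ.measurableSet).2 (.of_forall fun x hx => ?_)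
    have h1 := hM t htab x (subset_closure hx)
    have h0 := (norm_nonneg _).trans h1
    rw [norm_mul]
    refine mul_le_mul ((abs_dotProduct_le _ _).trans ?_) (hE x (subset_closure hx))
      (norm_nonneg _) (by positivity)
    gcongr
  · have h1 := ((h.continuousOn_slice (Ioo_subset_Ico_self ht)).mono
      (subset_closure (s := Ω))).aestronglyMeasurable (μ := volume) hΩ.measurableSet
    have h2 : Measurable fun x => fderiv ℝ g (t, x) (1, 0) :=
      (measurable_fderiv_apply_const ℝ g (1, 0)).comp measurable_prodMk_left
    have h3 : AEStronglyMeasurable (fun x => w t x ⬝ᵥ fderiv ℝ g (t, x) (1, 0))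
        (volume.restrict Ω) := by
      refine Finset.aestronglyMeasurable_fun_sum _ fun i _ => ?_
      exact ((continuous_apply i).comp_aestronglyMeasurable h1).mul
        ((measurable_pi_apply i).comp h2).aestronglyMeasurable
    exact (h3.const_mul 2).mul (Real.continuous_exp.comp hμ).aestronglyMeasurable
  · refine (ae_restrict_iff' hΩ.measurableSet).2 (.of_forall fun x hx s hs => ?_)
    have h1 := hM s hs x (subset_closure hx)
    have h2 : ‖fderiv ℝ g (s, x) (1, 0)‖ ≤ M' := by
      refine (ContinuousLinearMap.le_of_opNorm_le _ (hM' s hs x hx) _).trans (le_of_eq ?_)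
      simp [Prod.norm_def]
    have h0 := (norm_nonneg _).trans h1
    have h0' := (norm_nonneg _).trans h2
    rw [norm_mul, norm_mul, Real.norm_two]
    refine mul_le_mul (mul_le_mul_of_nonneg_left ((abs_dotProduct_le _ _).trans ?_) two_pos.le)
      (hE x (subset_closure hx)) (norm_nonneg _) (by positivity)
    gcongr
  · refine (ae_restrict_iff' hΩ.measurableSet).2 (.of_forall fun x hx s hs => ?_)
    have h1 := hasDerivAt_dotProduct_mulVec
      (hasDerivAt_slice (h.differentiableAt hΩ (hT s hs) hx)) (M := 1) Matrix.isSymm_one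
    simp only [Matrix.one_mulVec] at h1
    exact h1.mul_const _

end Decay

/-! ### The dissipation inequality and exponential decay. -/

section Stability

variable {m : ℕ} {ι : Type*} [Fintype ι] {T : ℝ} {Ω : Set (Space (m + 1))}
  {A : Fin (m + 1) → Matrix ι ι ℝ} {B : Matrix ι ι ℝ} {w : ℝ → Space (m + 1) → ι → ℝ}
  {μ : Space (m + 1) → ℝ}

theorem gradient_apply {d : ℕ} (φ : Space d → ℝ) (x : Space d) (k : Fin d) :
    gradient φ x k = fderiv ℝ φ x (EuclideanSpace.single k 1) := by
  have h : fderiv ℝ φ x = InnerProductSpace.toDual ℝ _ (gradient φ x) := by simp [gradient]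
  rw [h, InnerProductSpace.toDual_apply_apply, EuclideanSpace.inner_single_right]
  simp

/-- Computed along the line `x + s v`, so that the one-variable rule for quadratic forms applies;
`hd` identifies the result with the full derivative. -/
theorem fderiv_quadraticForm_mul_exp {p : Space (m + 1) → ι → ℝ} {x : Space (m + 1)}
    (hp : DifferentiableAt ℝ p x) (hμ : DifferentiableAt ℝ μ x) {M : Matrix ι ι ℝ}
    (hM : M.IsSymm) (hd : DifferentiableAt ℝ (fun y => (p y ⬝ᵥ M *ᵥ p y) * Real.exp (μ y)) x)
    (v : Space (m + 1)) :
    fderiv ℝ (fun y => (p y ⬝ᵥ M *ᵥ p y) * Real.exp (μ y)) x v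
      = 2 * (p x ⬝ᵥ M *ᵥ fderiv ℝ p x v) * Real.exp (μ x)
        + (p x ⬝ᵥ M *ᵥ p x) * (Real.exp (μ x) * fderiv ℝ μ x v) := by
  have hl : HasDerivAt (fun s : ℝ => x + s • v) v 0 := by
    simpa using ((hasDerivAt_id (0 : ℝ)).smul_const v).const_add x
  have e0 : x + (0 : ℝ) • v = x := by simp
  have h1 : HasDerivAt (fun s : ℝ => p (x + s • v)) (fderiv ℝ p x v) 0 :=
    HasFDerivAt.comp_hasDerivAt (0 : ℝ) (by rw [e0]; exact hp.hasFDerivAt) hl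
  have h2 : HasDerivAt (fun s : ℝ => μ (x + s • v)) (fderiv ℝ μ x v) 0 :=
    HasFDerivAt.comp_hasDerivAt (0 : ℝ) (by rw [e0]; exact hμ.hasFDerivAt) hl
  have h3 := HasFDerivAt.comp_hasDerivAt (f := fun s : ℝ => x + s • v) (0 : ℝ)
    (by rw [e0]; exact hd.hasFDerivAt) hl
  have h4 := (hasDerivAt_dotProduct_mulVec h1 hM).mul h2.exp
  rw [e0] at h4
  exact h3.unique h4

theorem boundaryTerm_eq_sum (hΩ : IsOpen Ω) (hb : Bornology.IsBounded Ω)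
    (hP : HasPiecewiseC1Boundary Ω) {t : ℝ}
    (hf : ∀ k, HasBoundedDerivOn Ω fun x => (w t x ⬝ᵥ A k *ᵥ w t x) * Real.exp (μ x)) :
    boundaryTerm (fun k _ => A k) Ω μ w t
      = ∑ k, ∫ x in Ω, fderiv ℝ (fun x => (w t x ⬝ᵥ A k *ᵥ w t x) * Real.exp (μ x)) x
          (EuclideanSpace.single k 1) := by
  have hi : ∀ k, IntegrableOn (fun x => (w t x ⬝ᵥ A k *ᵥ w t x) * Real.exp (μ x)
      * outerNormal Ω x k) (frontier Ω) μHE[m] := fun k => by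
    have := integrableOn_mul_inner_outerNormal hΩ hb hP (hf k) (EuclideanSpace.single k 1)
    simpa [EuclideanSpace.inner_single_right] using this
  simp_rw [integral_fderiv_eq_integral_frontier hΩ hb hP (hf _)]
  rw [← integral_finsetSum _ fun k _ => hi k]
  -- The measure in `boundaryTerm` has dimension `m + 1 - 1`, which reduces to `m`.
  change ∫ x in frontier Ω, _ ∂μHE[m] = _
  congr 1
  ext x
  rw [Matrix.sum_mulVec, dotProduct_sum, Finset.sum_mul]
  refine Finset.sum_congr rfl fun k _ => ?_
  rw [Matrix.smul_mulVec, dotProduct_smul, smul_eq_mul]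
  ring

variable [DecidableEq ι]

/-- The pointwise dissipation inequality behind the decay of the Lyapunov function. -/
theorem IsFeasiblePotential.dissipation {C : ℝ}
    (hμ : IsFeasiblePotential (fun k _ => A k) (fun _ => B) C μ)
    {x : Space (m + 1)} {u ut : ι → ℝ} {ux : Fin (m + 1) → ι → ℝ}
    (heq : ut + ∑ k, A k *ᵥ ux k + B *ᵥ u = 0) :
    2 * (u ⬝ᵥ ut) * Real.exp (μ x) ≤
      -(∑ k, (2 * (u ⬝ᵥ A k *ᵥ ux k) * Real.exp (μ x)
        + (u ⬝ᵥ A k *ᵥ u) * (Real.exp (μ x) * gradient μ x k)))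
      - C * ((u ⬝ᵥ u) * Real.exp (μ x)) := by
  have h1 := (hμ.lmi x).dotProduct_mulVec_nonneg u
  rw [remainder_const, star_trivial, Matrix.neg_mulVec, Matrix.add_mulVec, Matrix.add_mulVec,
    Matrix.neg_mulVec, Matrix.add_mulVec, Matrix.smul_mulVec, Matrix.one_mulVec,
    Matrix.sum_mulVec, dotProduct_neg, dotProduct_add, dotProduct_add, dotProduct_neg,
    dotProduct_add, dotProduct_smul, dotProduct_sum, Matrix.dotProduct_mulVec u Bᵀ,
    Matrix.vecMul_transpose, dotProduct_comm (B *ᵥ u) u] at h1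
  simp only [Matrix.smul_mulVec, dotProduct_smul, smul_eq_mul] at h1
  have h2 := congrArg (u ⬝ᵥ ·) heq
  simp only [dotProduct_add, dotProduct_sum, dotProduct_zero] at h2
  have e : ∑ k, (2 * (u ⬝ᵥ A k *ᵥ ux k) * Real.exp (μ x)
        + (u ⬝ᵥ A k *ᵥ u) * (Real.exp (μ x) * gradient μ x k))
      = Real.exp (μ x) * (2 * (∑ k, u ⬝ᵥ A k *ᵥ ux k)
        + ∑ k, gradient μ x k * (u ⬝ᵥ A k *ᵥ u)) := by
    rw [mul_add, Finset.mul_sum, Finset.mul_sum, Finset.mul_sum, ← Finset.sum_add_distrib]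
    exact Finset.sum_congr rfl fun k _ => by ring
  have h3 := mul_nonneg (Real.exp_pos (μ x)).le h1
  have h4 := congrArg (2 * Real.exp (μ x) * ·) h2
  simp only [mul_zero] at h4
  rw [e]
  linarith

theorem IsFeasiblePotential.exists_hasDerivAt_lyapunov_le {C : ℝ}
    (hμ : IsFeasiblePotential (fun k _ => A k) (fun _ => B) C μ) (hA : ∀ k, (A k).IsSymm)
    (hΩ : IsOpen Ω) (hb : Bornology.IsBounded Ω) (hP : HasPiecewiseC1Boundary Ω)
    (h : IsClassicalSolution (fun k _ => A k) (fun _ => B) T Ω w)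
    {t : ℝ} (ht : t ∈ Ioo 0 T) (hbd : 0 ≤ boundaryTerm (fun k _ => A k) Ω μ w t) :
    ∃ L', HasDerivAt (lyapunov Ω μ w) L' t ∧ L' ≤ -C * lyapunov Ω μ w t := by
  obtain ⟨hi, hd⟩ := hasDerivAt_lyapunov hΩ hb hμ.contDiff.continuous h ht
  refine ⟨_, hd, ?_⟩
  have hc := hb.isCompact_closure
  have hq : ∀ M : Matrix ι ι ℝ,
      HasBoundedDerivOn Ω fun x => (w t x ⬝ᵥ M *ᵥ w t x) * Real.exp (μ x) := fun M =>
    (HasBoundedDerivOn.dotProduct_mulVec hΩ hc (h.hasBoundedDerivOn hΩ hb ht) M).mul hΩ hc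
      (.of_contDiff hc hμ.contDiff.exp)
  have hfi : ∀ k, IntegrableOn (fun x => fderiv ℝ
      (fun x => (w t x ⬝ᵥ A k *ᵥ w t x) * Real.exp (μ x)) x (EuclideanSpace.single k 1)) Ω :=
    fun k => (hq (A k)).integrableOn_fderiv hΩ hb.measure_lt_top _
  have hL : IntegrableOn (fun x => (w t x ⬝ᵥ w t x) * Real.exp (μ x)) Ω := by
    have := ((hq 1).continuousOn.integrableOn_compact (μ := volume) hc).mono_set
      (subset_closure (s := Ω))
    simpa only [Matrix.one_mulVec] using this
  have hs : IntegrableOn (fun x => ∑ k, fderiv ℝ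
      (fun x => (w t x ⬝ᵥ A k *ᵥ w t x) * Real.exp (μ x)) x (EuclideanSpace.single k 1)) Ω :=
    integrable_finsetSum _ fun k _ => hfi k
  have hle : ∫ x in Ω, 2 * (w t x ⬝ᵥ deriv (fun s => w s x) t) * Real.exp (μ x)
      ≤ ∫ x in Ω, (-(∑ k, fderiv ℝ
        (fun x => (w t x ⬝ᵥ A k *ᵥ w t x) * Real.exp (μ x)) x (EuclideanSpace.single k 1))
        - C * ((w t x ⬝ᵥ w t x) * Real.exp (μ x))) := by
    refine setIntegral_mono_on hi (hs.neg.sub (hL.const_mul C)) hΩ.measurableSet fun x hx => ?_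
    have hw := (hasFDerivAt_slice (h.differentiableAt hΩ ht hx)).differentiableAt
    have e : ∀ k, fderiv ℝ (fun x => (w t x ⬝ᵥ A k *ᵥ w t x) * Real.exp (μ x)) x
        (EuclideanSpace.single k 1) = _ := fun k =>
      fderiv_quadraticForm_mul_exp hw (hμ.contDiff.differentiable one_ne_zero x) (hA k)
        ((hq (A k)).differentiableOn.differentiableAt (hΩ.mem_nhds hx)) _
    simp only [e, ← gradient_apply]
    exact hμ.dissipation (x := x) (h.equation t ht x hx)
  -- By Gauss-Green the integrated divergence is exactly the boundary term, whose sign is given by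
  -- `hbd`.
  refine hle.trans (le_of_eq_of_le (integral_sub hs.neg (hL.const_mul C)) ?_)
  rw [integral_neg, integral_const_mul,
    integral_finsetSum _ fun k _ => hfi k, ← boundaryTerm_eq_sum hΩ hb hP fun k => hq (A k)]
  rw [lyapunov]
  linarith

/-- Exponential decay of the Lyapunov function of a feasible potential under dissipative boundary
values. -/
theorem IsFeasiblePotential.lyapunov_le {C : ℝ}
    (hμ : IsFeasiblePotential (fun k _ => A k) (fun _ => B) C μ) (hA : ∀ k, (A k).IsSymm)
    (hΩ : IsOpen Ω) (hb : Bornology.IsBounded Ω) (hP : HasPiecewiseC1Boundary Ω)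
    (h : IsClassicalSolution (fun k _ => A k) (fun _ => B) T Ω w)
    (hbd : ∀ t ∈ Ico 0 T, 0 ≤ boundaryTerm (fun k _ => A k) Ω μ w t) :
    ∀ t ∈ Ico 0 T, lyapunov Ω μ w t ≤ Real.exp (-C * t) * lyapunov Ω μ w 0 := by
  intro t ht
  -- Gronwall with the integrating factor `exp(C s)`: `L' ≤ -C L` makes the product nonincreasing.
  have hd : ∀ s ∈ Ioo 0 t, ∃ D, HasDerivAt (fun s => Real.exp (C * s) * lyapunov Ω μ w s) D s ∧
      D ≤ 0 := fun s hs => by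
    have hsT : s ∈ Ioo 0 T := ⟨hs.1, hs.2.trans ht.2⟩
    obtain ⟨L', hL', hle⟩ := hμ.exists_hasDerivAt_lyapunov_le hA hΩ hb hP h hsT
      (hbd s (Ioo_subset_Ico_self hsT))
    refine ⟨_, (((hasDerivAt_id s).const_mul C).exp).mul hL', ?_⟩
    have := mul_nonneg (Real.exp_pos (C * s)).le (sub_nonneg.2 hle)
    simp only [id, mul_one]
    nlinarith
  have hanti : AntitoneOn (fun s => Real.exp (C * s) * lyapunov Ω μ w s) (Icc 0 t) := by
    refine antitoneOn_of_deriv_nonpos (convex_Icc 0 t) ?_ ?_ ?_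
    · exact (by fun_prop : Continuous fun s => Real.exp (C * s)).continuousOn.mul
        (lyapunov_continuousOn hΩ hb hμ.contDiff.continuous h ht.2)
    · rw [interior_Icc]
      intro s hs
      obtain ⟨D, hD, -⟩ := hd s hs
      exact hD.differentiableAt.differentiableWithinAt
    · rw [interior_Icc]
      intro s hs
      obtain ⟨D, hD, hD0⟩ := hd s hs
      rwa [hD.deriv]
  have h1 := hanti (left_mem_Icc.2 ht.1) (right_mem_Icc.2 ht.1) ht.1
  simp only [mul_zero, Real.exp_zero, one_mul] at h1
  rw [neg_mul, Real.exp_neg, ← div_eq_inv_mul, le_div_iff₀ (Real.exp_pos _), mul_comm]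
  exact h1

end Stability

/-- For `d = 0` the sum in `negative` is the zero matrix, which has the eigenvalue `0` because `p >
0`. This excludes the truncated value of `d - 1` and allows writing `d = m + 1` in Gauss-Green. -/
theorem SatisfiesSSC.dim_pos {d p r : ℕ} (hp : 0 < p)
    {a : Fin d → Matrix (Fin p) (Fin p) ℝ} {b : Fin d → Matrix (Fin p) (Fin r) ℝ}
    {c : Fin d → Matrix (Fin r) (Fin p) ℝ} {e : Fin d → Matrix (Fin r) (Fin r) ℝ}
    {f : Matrix (Fin r) (Fin r) ℝ}
    {X₁ : Matrix (Fin p) (Fin p) ℝ} {X₂ : Matrix (Fin r) (Fin r) ℝ} {α : Fin d → ℝ}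
    (h : SatisfiesSSC a b c e f X₁ X₂ α) : 0 < d := by
  refine Nat.pos_of_ne_zero fun hd => ?_
  subst hd
  refine lt_irrefl _ (h.negative 0 (Module.End.hasEigenvalue_of_hasEigenvector
    (x := fun _ => 1) ⟨?_, ?_⟩))
  · simp
  · intro h0
    exact one_ne_zero (congrFun h0 ⟨0, hp⟩)

end HypStab

theorem theorem1 {d p r : ℕ} (hp : 0 < p) (hr : 0 < r)
    (a : Fin d → Matrix (Fin p) (Fin p) ℝ) (b : Fin d → Matrix (Fin p) (Fin r) ℝ)
    (c : Fin d → Matrix (Fin r) (Fin p) ℝ) (e : Fin d → Matrix (Fin r) (Fin r) ℝ)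
    (f : Matrix (Fin r) (Fin r) ℝ)
    (X₁ : Matrix (Fin p) (Fin p) ℝ) (X₂ : Matrix (Fin r) (Fin r) ℝ) (α : Fin d → ℝ)
    (hSSC : HypStab.SatisfiesSSC a b c e f X₁ X₂ α)
    (Abar : Fin d → Matrix (Fin p ⊕ Fin r) (Fin p ⊕ Fin r) ℝ)
    (hAbar : ∀ k, Abar k = Matrix.fromBlocks (a k) (b k) (c k) (e k))
    (Bbar A₀ B : Matrix (Fin p ⊕ Fin r) (Fin p ⊕ Fin r) ℝ)
    (hBbar : Bbar = Matrix.fromBlocks 0 0 0 f)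
    (hA₀ : A₀ = Matrix.fromBlocks X₁ 0 0 X₂)
    (A : Fin d → Matrix (Fin p ⊕ Fin r) (Fin p ⊕ Fin r) ℝ)
    (hA : ∀ k, A k = HypStab.symmetrized A₀ (Abar k))
    (hB : B = HypStab.symmetrized A₀ Bbar) :
    (∀ k, (A k).IsSymm) ∧
    (∀ (Ω : Set (HypStab.Space d)) (T : ℝ) (U : ℝ → HypStab.Space d → Fin p ⊕ Fin r → ℝ),
      IsOpen Ω →
      HypStab.IsClassicalSolution (fun k _ => Abar k) (fun _ => Bbar) T Ω U →
      HypStab.IsClassicalSolution (fun k _ => A k) (fun _ => B) T Ω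
        (fun t x => CFC.sqrt A₀ *ᵥ U t x)) ∧
    ∃ K₀ > 0, ∀ K ≥ K₀, ∃ C > 0,
      HypStab.IsFeasiblePotential (fun k _ => A k) (fun _ => B) C
        (HypStab.linearPotential α K) ∧
      ∀ (Ω : Set (HypStab.Space d)) (T : ℝ) (U : ℝ → HypStab.Space d → Fin p ⊕ Fin r → ℝ)
        (w : ℝ → HypStab.Space d → Fin p ⊕ Fin r → ℝ),
        IsOpen Ω → Bornology.IsBounded Ω → HypStab.HasPiecewiseC1Boundary Ω →
        HypStab.IsClassicalSolution (fun k _ => Abar k) (fun _ => Bbar) T Ω U →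
        (∀ t x, w t x = CFC.sqrt A₀ *ᵥ U t x) →
        (∀ t ∈ Set.Ico 0 T, 0 ≤ HypStab.boundaryTerm (fun k _ => A k) Ω
          (HypStab.linearPotential α K) w t) →
        ∀ t ∈ Set.Ico 0 T,
          HypStab.lyapunov Ω (HypStab.linearPotential α K) w t
            ≤ Real.exp (-C * t) * HypStab.lyapunov Ω (HypStab.linearPotential α K) w 0 := by
  subst hBbar hA₀ hB
  obtain rfl : Abar = fun k => Matrix.fromBlocks (a k) (b k) (c k) (e k) := funext hAbar
  obtain rfl : A = fun k => HypStab.symmetrized (Matrix.fromBlocks X₁ 0 0 X₂)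
    (Matrix.fromBlocks (a k) (b k) (c k) (e k)) := funext hA
  have hsymm : ∀ k, (HypStab.symmetrized (Matrix.fromBlocks X₁ 0 0 X₂)
      (Matrix.fromBlocks (a k) (b k) (c k) (e k))).IsSymm := fun k =>
    HypStab.isSymm_symmetrized (hSSC.symmetric k)
  have htrans : ∀ (Ω : Set (HypStab.Space d)) (T : ℝ)
      (U : ℝ → HypStab.Space d → Fin p ⊕ Fin r → ℝ), IsOpen Ω →
      HypStab.IsClassicalSolution (fun k _ => Matrix.fromBlocks (a k) (b k) (c k) (e k))
        (fun _ => Matrix.fromBlocks 0 0 0 f) T Ω U →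
      HypStab.IsClassicalSolution
        (fun k _ => HypStab.symmetrized (Matrix.fromBlocks X₁ 0 0 X₂)
          (Matrix.fromBlocks (a k) (b k) (c k) (e k)))
        (fun _ => HypStab.symmetrized (Matrix.fromBlocks X₁ 0 0 X₂)
          (Matrix.fromBlocks 0 0 0 f)) T Ω
        (fun t x => CFC.sqrt (Matrix.fromBlocks X₁ 0 0 X₂) *ᵥ U t x) := fun Ω T U hΩ hU =>
    hU.mulVec hΩ (fun k => HypStab.symmetrized_mul_sqrt hSSC.posDef _)
      (HypStab.symmetrized_mul_sqrt hSSC.posDef _)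
  refine ⟨hsymm, htrans, ?_⟩
  obtain ⟨K₀, hK₀, hK⟩ := hSSC.exists_isFeasiblePotential
  refine ⟨K₀, hK₀, fun K hKK => ?_⟩
  obtain ⟨C, hC, hμ⟩ := hK K hKK
  refine ⟨C, hC, hμ, fun Ω T U w hΩ hb hP hU hw hbd => ?_⟩
  obtain rfl : w = fun t x => CFC.sqrt (Matrix.fromBlocks X₁ 0 0 X₂) *ᵥ U t x :=
    funext fun t => funext fun x => hw t x
  obtain ⟨m, rfl⟩ := Nat.exists_eq_add_one.2 (hSSC.dim_pos hp)
  exact hμ.lyapunov_le hsymm hΩ hb hP (htrans Ω T U hΩ hU) hbd
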